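/- Fix integers $\ell,n,m,p,q\ge 0$. **Data.** Grid points $u_1,\dots,u_n\in\mathbb R^2$, a generating function $\varphi:\mathbb R^2\to\mathbb R$ and transformations $\tau_t:\mathbb R^2\to\mathbb R^2$ depending on $t\in\mathbb R^p$ define the interpolation matrix $\Phi(t)=\big(\varphi(\tau_t(u_k)-u_{k'})\big)_{k,k'}\in\mathbb R^{n\times n}$. Let $A_1,\dots,A_\ell\in\mathbb R^{m\times n}$ and $y=(y_1,\dots,y_\ell)\in(\mathbb R^m)^\ell$. For $x=(x_0,\dots,x_\ell)\in(\mathbb R^n)^{\ell+1}$ and $\theta=(\theta_1,\dots,\theta_\ell)\in(\mathbb R^p)^\ell$ let $A(\theta)x$ be the vector with blocks $A_j\Phi(\theta_j)x_0+A_jx_j$, $1\le j\le\ell$. Let $C_j=\{t\in\mathbb R^p:\underline\theta_j\le t\le\overline\theta_j\}$ (coordinatewise) with $\underline\theta_j\le\overline\theta_j$, let $C=C_1\times\dots\times C_\ell$, and let $\iota_C$ be $0$ on $C$ and $+\infty$ off $C$. Let $f:(\mathbb R^n)^{\ell+1}\to\mathbb R\cup\{+\infty\}$ be proper, lower semicontinuous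 and convex, let $\kappa>0$, and put $$L(x,\theta)=f(x)+\kappa\|A(\theta)x-y\|_2^2+\iota_C(\theta).$$ For $\mu>0$ let $\mathrm{Huber}(\alpha)=\sum_i h(\alpha_i)$, where $h(a)=a^2/(2\mu)$ if $|a|<\mu$ and $h(a)=|a|-\mu/2$ otherwise. Let $W\in\mathbb R^{(\ell+1)n\times(\ell+1)q}$. **Algorithm 1.** Given $\lambda_x^k>0$ $(k\in\mathbb N)$ and $\lambda_\theta>0$, start from $x^0=0$ and any $\theta^0\in C$. For $k=0,1,2,\dots$: 1. let $x^{k+1}$ be a minimizer of $x\mapsto L(x,\theta^k)+\frac{\lambda_x^k}{2}\mathrm{Huber}(W^T(x-x^k))$; 2. for each $j$, put $Q_j(t)=\|A_j\Phi(t)x_0^{k+1}+A_jx_j^{k+1}-y_j\|_2^2$, let $J_j$ be the Jacobian at $\theta_j^k$ of $t\mapsto\Phi(t)x_0^{k+1}$, put $H_j=2(A_jJ_j)^T(A_jJ_j)$, and let $\theta_j^{k+1}$ be the minimizer over $t\in C_j$ of $$\langle\nabla Q_j(\theta_j^k),t-\theta_j^k\rangle+\tfrac12\langle t-\theta_j^k,(H_j+2^i\lambda_\theta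 I)(t-\theta_j^k)\rangle,$$ where $i$ is the smallest positive integer for which this minimizer satisfies, with $d=\theta_j^{k+1}-\theta_j^k$, $$Q_j(\theta_j^{k+1})\le Q_j(\theta_j^k)+\langle\nabla Q_j(\theta_j^k),d\rangle+\tfrac12\langle d,(H_j+(2^i-1)\lambda_\theta I)d\rangle.$$ **Theorem.** Assume that $L$ is bounded below, that the entries of $\Phi$ are $C^2$ functions of $t\in\mathbb R^p$, that $WW^T=I$, and that $0<\lambda_{\min}\le\lambda_x^k,\lambda_\theta\le\lambda_{\max}$ for all $k$. Then Algorithm 1 is well defined: from every state with parameters in $C$, the minimization problem of step 1 has a solution, each minimization problem of step 2 has a unique solution, and an index $i$ as required in step 2 exists; in particular, for every $\theta^0\in C$ the algorithm generates an infinite sequence. Every sequence $(x^k,\theta^k)_{k\in\mathbb N}$ that it generates satisfies: 1. for all $k\ge 0$, $$L(x^{k+1},\theta^{k+1})+\frac{\lambda_{\min}}2\Big[\kappa\|\theta^{k+1}-\theta^k\|_2^2+\mathrm{Huber}\big(W^T(x^{k+1}-x^k)\big)\Big]\le L(x^k,\theta^k);$$ 2. $\lim_{k\to\infty}\big(\|x^{k+1}-x^k\|_2+\|\theta^{k+1}-\theta^k\|_2\big)=0$;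 3. if $L$ has the Kurdyka–Łojasiewicz property and $(x^k)$ is bounded, then $(x^k,\theta^k)$ converges to a critical point of $L$, that is, to a point $z^*$ with $0\in\partial L(z^*)$. Here $\partial L$ is the limiting subdifferential. The Fréchet subdifferential of $L$ at a point $z$ with $L(z)<+\infty$ is the set of $v$ with $\liminf_{w\to z,\,w\ne z}(L(w)-L(z)-\langle v,w-z\rangle)/\|w-z\|\ge0$, and it is empty where $L=+\infty$; $v\in\partial L(z)$ means that $L(z)<+\infty$ and that there are $z_k\to z$ with $L(z_k)\to L(z)$ and Fréchet subgradients $v_k$ of $L$ at $z_k$ with $v_k\to v$. The Kurdyka–Łojasiewicz property of $L$ means that for every $\bar z$ with $\partial L(\bar z)\ne\emptyset$ there are $\eta\in(0,+\infty]$, a neighbourhood $U$ of $\bar z$ and a continuous concave function $\phi:[0,\eta)\to[0,\infty)$ with $\phi(0)=0$, $\phi$ of class $C^1$ on $(0,\eta)$ and $\phi'>0$ there, such that $\phi'(L(z)-L(\bar z))\,\mathrm{dist}(0,\partial L(z))\ge1$ for all $z\in U$ with $L(\bar z)<L(z)<L(\bar z)+\eta$, where $\mathrm{dist}(0,\emptyset)=+\infty$.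 -/

import Mathlib

open Filter Topology

noncomputable section

namespace MultiView

/-! ### Variational analysis for functions with values in `ℝ ∪ {+∞}`

Extended-real functions are `EReal`-valued; the value `⊥` is excluded by hypothesis where needed. -/

section Variational

variable {E : Type*} [NormedAddCommGroup E] [InnerProductSpace ℝ E]

/-- `g` is proper: never `-∞`, and finite somewhere. -/
def IsProper (g : E → EReal) : Prop :=
  (∀ z, g z ≠ ⊥) ∧ ∃ z, g z ≠ ⊤

/-- `g` is convex: its epigraph is a convex set. -/
def IsConvexFun (g : E → EReal) : Prop :=
  Convex ℝ {q : E × ℝ | g q.1 ≤ (q.2 : EReal)}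

/-- The Fréchet subdifferential of `g` at `z`: empty off the domain, and otherwise the set of `v`
with `liminf_{w → z, w ≠ z} (g w - g z - ⟪v, w - z⟫) / ‖w - z‖ ≥ 0`. -/
def frechetSubdiff (g : E → EReal) (z : E) : Set E :=
  {v | g z ≠ ⊤ ∧ ∀ ε : ℝ, 0 < ε → ∀ᶠ w in 𝓝 z,
    g z + ((inner ℝ v (w - z) - ε * ‖w - z‖ : ℝ) : EReal) ≤ g w}

/-- The (limiting) subdifferential of `g` at `z`. -/
def subdiff (g : E → EReal) (z : E) : Set E :=
  {v | g z ≠ ⊤ ∧ ∃ (zs vs : ℕ → E), Tendsto zs atTop (𝓝 z) ∧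
    Tendsto (fun k => g (zs k)) atTop (𝓝 (g z)) ∧
    (∀ k, vs k ∈ frechetSubdiff g (zs k)) ∧ Tendsto vs atTop (𝓝 v)}

/-- A critical point of `g`. -/
def IsCritical (g : E → EReal) (z : E) : Prop := (0 : E) ∈ subdiff g z

/-- The Kurdyka–Łojasiewicz property of `g` at the point `zbar`. The distance to the empty set
is `+∞`. -/
def KLAt (g : E → EReal) (zbar : E) : Prop :=
  ∃ η : EReal, 0 < η ∧ ∃ U ∈ 𝓝 zbar, ∃ φ : ℝ → ℝ,
    ContinuousOn φ {s : ℝ | 0 ≤ s ∧ (s : EReal) < η} ∧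
    ConcaveOn ℝ {s : ℝ | 0 ≤ s ∧ (s : EReal) < η} φ ∧
    (∀ s : ℝ, 0 ≤ s → (s : EReal) < η → 0 ≤ φ s) ∧
    φ 0 = 0 ∧
    ContDiffOn ℝ 1 φ {s : ℝ | 0 < s ∧ (s : EReal) < η} ∧
    (∀ s : ℝ, 0 < s → (s : EReal) < η → 0 < deriv φ s) ∧
    ∀ z ∈ U, g zbar < g z → g z < g zbar + η →
      1 ≤ ENNReal.ofReal (deriv φ ((g z).toReal - (g zbar).toReal)) *
        Metric.infEDist (0 : E) (subdiff g z)

/-- `g` has the Kurdyka–Łojasiewicz property: it holds at every point of the domain of the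
subdifferential. -/
def HasKL (g : E → EReal) : Prop :=
  ∀ zbar, (subdiff g zbar).Nonempty → KLAt g zbar

end Variational

/-! ### The spaces

All of them carry the Euclidean norm of the concatenated vector. -/

/-- Stacks `x = (x₀, …, x_ℓ)` of `ℓ + 1` images with `n` pixels. -/
abbrev Images (ℓ n : ℕ) : Type := PiLp 2 (fun _ : Fin (ℓ + 1) => EuclideanSpace ℝ (Fin n))

/-- Stacks `θ = (θ₁, …, θ_ℓ)` of `ℓ` vectors of `p` transformation parameters. -/
abbrev Params (ℓ p : ℕ) : Type := PiLp 2 (fun _ : Fin ℓ => EuclideanSpace ℝ (Fin p))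

/-- Stacks `y = (y₁, …, y_ℓ)` of `ℓ` measurement vectors of length `m`. -/
abbrev Meas (ℓ m : ℕ) : Type := PiLp 2 (fun _ : Fin ℓ => EuclideanSpace ℝ (Fin m))

/-- The data of the multi-view reconstruction problem (data only, no assumption on it). -/
structure Model (ℓ n m p q : ℕ) where
  /-- the grid points -/
  grid : Fin n → EuclideanSpace ℝ (Fin 2)
  /-- the generating function of the image space -/
  kernel : EuclideanSpace ℝ (Fin 2) → ℝ
  /-- the parametrized geometric transformations -/
  trans : EuclideanSpace ℝ (Fin p) → EuclideanSpace ℝ (Fin 2) → EuclideanSpace ℝ (Fin 2)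
  /-- the measurement matrix of each observer -/
  sens : Fin ℓ → Matrix (Fin m) (Fin n) ℝ
  /-- the measurements -/
  meas : Meas ℓ m
  /-- the prior `f` -/
  prior : Images ℓ n → EReal
  /-- the weight `κ` of the fidelity term -/
  κ : ℝ
  /-- the smoothing parameter of the Huber function -/
  μ : ℝ
  /-- the tight frame -/
  W : Matrix (Fin (ℓ + 1) × Fin n) (Fin (ℓ + 1) × Fin q) ℝ
  /-- lower bounds on the parameters -/
  lower : Fin ℓ → Fin p → ℝ
  /-- upper bounds on the parameters -/
  upper : Fin ℓ → Fin p → ℝ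

/-- The Huber function with smoothing parameter `μ`. -/
def huber {ι : Type*} [Fintype ι] (μ : ℝ) (α : ι → ℝ) : ℝ :=
  ∑ i, if |α i| < μ then α i ^ 2 / (2 * μ) else |α i| - μ / 2

namespace Model

variable {ℓ n m p q : ℕ} (M : Model ℓ n m p q)

/-- The interpolation matrix `Φ(t)`, with entries `kernel (trans t (u k) - u k')`. -/
def interp (t : EuclideanSpace ℝ (Fin p)) : Matrix (Fin n) (Fin n) ℝ :=
  Matrix.of fun k k' => M.kernel (M.trans t (M.grid k) - M.grid k')

/-- The product `A(θ) x`, where `A(θ)` is the block matrix whose `j`-th block row is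
`[A_j Φ(θ_j), 0, …, A_j, …, 0]`: its `j`-th block is `A_j Φ(θ_j) x₀ + A_j x_j`. -/
def sensing (θ : Params ℓ p) (x : Images ℓ n) : Meas ℓ m :=
  WithLp.toLp 2 fun j => WithLp.toLp 2
    ((M.sens j * M.interp (θ j)).mulVec (x 0).ofLp + (M.sens j).mulVec (x j.succ).ofLp)

/-- The box `C_j`. -/
def box (j : Fin ℓ) : Set (EuclideanSpace ℝ (Fin p)) :=
  {t | ∀ i, M.lower j i ≤ t i ∧ t i ≤ M.upper j i}

/-- The product `C` of the boxes. -/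
def constraint : Set (Params ℓ p) := {θ | ∀ j, θ j ∈ M.box j}

open Classical in
/-- The objective `L(x, θ) = f(x) + κ ‖A(θ) x - y‖² + ι_C(θ)`. -/
def obj (x : Images ℓ n) (θ : Params ℓ p) : EReal :=
  M.prior x + ((M.κ * ‖M.sensing θ x - M.meas‖ ^ 2 : ℝ) : EReal) +
    (if θ ∈ M.constraint then 0 else ⊤)

/-- The objective as a function on the Euclidean product space. -/
def objPair (z : WithLp 2 (Images ℓ n × Params ℓ p)) : EReal := M.obj z.fst z.snd

/-- The cost-to-move `Huber(Wᵀ d)` of a displacement `d` of the images. -/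
def moveCost (d : Images ℓ n) : ℝ :=
  huber M.μ (M.W.transpose.mulVec fun a => d a.1 a.2)

/-- First step: `x'` minimizes `L(·, θ) + (lam / 2) Huber(Wᵀ(· - x))`. -/
def IsStepOne (lam : ℝ) (x : Images ℓ n) (θ : Params ℓ p) (x' : Images ℓ n) : Prop :=
  ∀ z, M.obj x' θ + ((lam / 2 * M.moveCost (x' - x) : ℝ) : EReal) ≤
    M.obj z θ + ((lam / 2 * M.moveCost (z - x) : ℝ) : EReal)

/-- The fidelity term of the `j`-th observation, as a function of `θ_j`, with images `x`. -/
def fid (x : Images ℓ n) (j : Fin ℓ) (t : EuclideanSpace ℝ (Fin p)) : ℝ :=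
  ‖WithLp.toLp 2 ((M.sens j * M.interp t).mulVec (x 0).ofLp +
    (M.sens j).mulVec (x j.succ).ofLp) - M.meas j‖ ^ 2

/-- The entrywise partial derivative of the interpolation matrix with respect to the `i`-th
parameter. -/
def interpDeriv (i : Fin p) (t : EuclideanSpace ℝ (Fin p)) : Matrix (Fin n) (Fin n) ℝ :=
  Matrix.of fun k k' => fderiv ℝ (fun s => M.interp s k k') t (EuclideanSpace.single i 1)

/-- The Jacobian `J(t)` of `t ↦ Φ(t) x₀`; its `i`-th column is `∂_i Φ(t) x₀`. -/
def jac (x : Images ℓ n) (t : EuclideanSpace ℝ (Fin p)) : Matrix (Fin n) (Fin p) ℝ :=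
  Matrix.of fun k i => (M.interpDeriv i t).mulVec (x 0).ofLp k

/-- The approximate Hessian `H = 2 (A_j J)ᵀ (A_j J)` of the `j`-th fidelity term. -/
def hess (x : Images ℓ n) (j : Fin ℓ) (t : EuclideanSpace ℝ (Fin p)) :
    Matrix (Fin p) (Fin p) ℝ :=
  (2 : ℝ) • ((M.sens j * M.jac x t).transpose * (M.sens j * M.jac x t))

/-- The quadratic model `⟨∇Q_j(t), s - t⟩ + ½ ⟨s - t, (H(t) + c I)(s - t)⟩`. -/
def quadModel (x : Images ℓ n) (j : Fin ℓ) (t : EuclideanSpace ℝ (Fin p)) (c : ℝ)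
    (s : EuclideanSpace ℝ (Fin p)) : ℝ :=
  inner ℝ (gradient (M.fid x j) t) (s - t) +
    1 / 2 * ((s - t).ofLp ⬝ᵥ
      (M.hess x j t + c • (1 : Matrix (Fin p) (Fin p) ℝ)).mulVec (s - t).ofLp)

/-- `s` solves the constrained quadratic problem with index `i`. -/
def IsTrial (lam : ℝ) (x : Images ℓ n) (j : Fin ℓ) (t : EuclideanSpace ℝ (Fin p)) (i : ℕ)
    (s : EuclideanSpace ℝ (Fin p)) : Prop :=
  s ∈ M.box j ∧ ∀ r ∈ M.box j,
    M.quadModel x j t (2 ^ i * lam) s ≤ M.quadModel x j t (2 ^ i * lam) r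

/-- `s` passes the sufficient-decrease test with index `i`. -/
def IsAccepted (lam : ℝ) (x : Images ℓ n) (j : Fin ℓ) (t : EuclideanSpace ℝ (Fin p)) (i : ℕ)
    (s : EuclideanSpace ℝ (Fin p)) : Prop :=
  M.fid x j s ≤ M.fid x j t + M.quadModel x j t ((2 ^ i - 1) * lam) s

/-- Second step for the observation `j`: `s` solves the quadratic problem, where the index `i` is
the smallest positive integer whose solution passes the test. -/
def IsStepTwo (lam : ℝ) (x : Images ℓ n) (j : Fin ℓ) (t s : EuclideanSpace ℝ (Fin p)) : Prop :=
  ∃ i : ℕ,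
    IsLeast {i' : ℕ | 1 ≤ i' ∧ ∃ r, M.IsTrial lam x j t i' r ∧ M.IsAccepted lam x j t i' r} i ∧
    M.IsTrial lam x j t i s ∧ M.IsAccepted lam x j t i s

/-- `(x k, θ k)` is a sequence generated by the algorithm, with cost-to-move parameters `lamX k`
for the images and `lamT` for the transformation parameters. -/
structure IsRun (lamX : ℕ → ℝ) (lamT : ℝ) (x : ℕ → Images ℓ n) (θ : ℕ → Params ℓ p) : Prop where
  init_x : x 0 = 0
  init_θ : θ 0 ∈ M.constraint
  step_one : ∀ k, M.IsStepOne (lamX k) (x k) (θ k) (x (k + 1))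
  step_two : ∀ k j, M.IsStepTwo lamT (x (k + 1)) j (θ k j) (θ (k + 1) j)

end Model

end MultiView

end

/-!
The algorithm is an alternating descent method, and the proof follows the usual pattern for such
methods under the Kurdyka–Łojasiewicz inequality: sufficient decrease, a relative error bound for
subgradients, and continuity of the objective along convergent subsequences.

*The steps exist.* Since `W Wᵀ = 1`, the map `Wᵀ` is an isometry, so the Huber cost-to-move grows
linearly (`norm_sub_le_moveCost`); with an objective that is lower semicontinuous and bounded
below, the first step has a minimizer. The quadratic models of the second step are
`quadratic ∇Q (A_j J) c`, strongly convex functions on a compact box. The derivative of `Q_j` is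
Lipschitz on the box, uniformly in bounded images, so the sufficient-decrease test is passed once
`2 ^ i` exceeds a constant (`exists_forall_isAccepted`). Minimality of `i` then bounds the accepted
`2 ^ i` (`exists_isStepTwo_bound`).

*Decrease.* Comparing the minimizer of the quadratic model with the base point leaves
`(lam / 2) ‖θ' - θ‖²` after the test, and the first step contributes the cost-to-move
(`IsRun.obj_succ_add_le`). The values are bounded below, so the steps tend to zero
(`IsRun.tendsto_steps`); in particular the Huber function is eventually evaluated only where it is
the quadratic `‖d‖² / (2 μ)`, and no derivative is needed elsewhere.

*Relative error.* The first-order conditions of the two steps add up to a Fréchet subgradient at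
the new iterate: the difference of the gradients of the fidelity term at `(x', θ')` and `(x', θ)`,
minus terms linear in the displacement (`mem_frechetSubdiff`). All of it is bounded by a constant
times the step length (`exists_subgradient_bound`).

*Convergence.* At an accumulation point the objective equals the limit of the values
(`IsRun.objPair_eq_of_tendsto`), so the accumulation point is critical, and the
Kurdyka–Łojasiewicz inequality there forces the steps to be summable (`tendsto_of_klAt`).
-/

open Filter Topology

noncomputable section

namespace MultiView

/-! ### Convergence under the Kurdyka–Łojasiewicz property -/

/-- A trapping argument: if the step lengths `δ k = dist (z (k + 1)) (z k)` satisfy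
`2 δ (k + 1) ≤ δ k + (ψ (k + 1) - ψ (k + 2))` as long as the sequence stays in a ball, and the
sequence starts close enough to the centre, then it never leaves the ball and has finite length. -/
lemma cauchySeq_of_step_recursion {E : Type*} [PseudoMetricSpace E] {z : ℕ → E} {c : E} {ρ : ℝ}
    {ψ : ℕ → ℝ} (hψ : ∀ k, 0 ≤ ψ k)
    (hrec : ∀ k, dist (z (k + 1)) c < ρ →
      2 * dist (z (k + 2)) (z (k + 1)) ≤ dist (z (k + 1)) (z k) + (ψ (k + 1) - ψ (k + 2)))
    (hstart : dist (z 1) c + dist (z 1) (z 0) + ψ 1 < ρ) :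
    CauchySeq z := by
  have key : ∀ n, (∑ i ∈ Finset.range n, dist (z (i + 2)) (z (i + 1))) + dist (z (n + 1)) (z n)
        + ψ (n + 1) ≤ dist (z 1) (z 0) + ψ 1 ∧
      dist (z (n + 1)) c ≤
        dist (z 1) c + ∑ i ∈ Finset.range n, dist (z (i + 2)) (z (i + 1)) := by
    intro n
    induction n with
    | zero => simp
    | succ n ih =>
      obtain ⟨h1, h2⟩ := ih
      have hlt : dist (z (n + 1)) c < ρ := by
        have := hψ (n + 1)
        have := dist_nonneg (x := z (n + 1)) (y := z n)
        linarith
      have h3 := hrec n hlt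
      rw [Finset.sum_range_succ]
      refine ⟨by linarith, ?_⟩
      have := dist_triangle (z (n + 2)) (z (n + 1)) c
      linarith
  have hsum : Summable fun i => dist (z (i + 2)) (z (i + 1)) := by
    refine summable_of_sum_range_le (c := dist (z 1) (z 0) + ψ 1) (fun _ => dist_nonneg) fun n => ?_
    have := (key n).1
    have := hψ (n + 1)
    have := dist_nonneg (x := z (n + 1)) (y := z n)
    linarith
  refine cauchySeq_of_summable_dist ((summable_nat_add_iff 1).1 ?_)
  simpa only [Nat.succ_eq_add_one, add_assoc, Nat.reduceAdd, dist_comm] using hsum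

section

variable {E : Type*} [NormedAddCommGroup E] [InnerProductSpace ℝ E]

/-- The Kurdyka–Łojasiewicz inequality combined with concavity of the desingularizing function
turns sufficient decrease and the relative error bound into a recursion for the step lengths. -/
lemma two_mul_step_le {a b d e w s s' ψ ψ' D : ℝ} (ha : 0 < a) (hb : 0 ≤ b) (hd : 0 ≤ d)
    (hD : 0 ≤ D) (hdec : a * e ^ 2 ≤ s - s') (hw : w ≤ b * d) (hKL : 1 ≤ D * w)
    (hslope : D * (s - s') ≤ ψ - ψ') :
    2 * e ≤ d + (b / a * ψ - b / a * ψ') := by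
  have h1 : a * e ^ 2 * 1 ≤ a * e ^ 2 * (D * (b * d)) := by
    refine mul_le_mul_of_nonneg_left (hKL.trans ?_) (by positivity)
    exact mul_le_mul_of_nonneg_left hw hD
  have h2 : (b * d) * (D * (a * e ^ 2)) ≤ (b * d) * (ψ - ψ') := by
    refine mul_le_mul_of_nonneg_left (le_trans ?_ hslope) (by positivity)
    exact mul_le_mul_of_nonneg_left hdec hD
  set X := b / a * ψ - b / a * ψ' with hX
  have hX' : a * X = b * (ψ - ψ') := by rw [hX]; field_simp
  have h3 : e ^ 2 ≤ d * X := by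
    have : a * e ^ 2 ≤ a * (d * X) := by
      calc a * e ^ 2 ≤ (b * d) * (ψ - ψ') := by linarith
        _ = a * (d * X) := by rw [mul_left_comm a d X, hX']; ring
    exact le_of_mul_le_mul_left this ha
  have hs : 0 ≤ d + X := by
    rcases hd.eq_or_lt with h0 | h0
    · have : D * w ≤ 0 := mul_nonpos_of_nonneg_of_nonpos hD (by simpa [← h0] using hw)
      linarith
    · have : 0 ≤ X := nonneg_of_mul_nonneg_right ((sq_nonneg e).trans h3) h0
      linarith
  refine abs_le_of_sq_le_sq' ?_ hs |>.2
  nlinarith [sq_nonneg (d - X)]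

omit [InnerProductSpace ℝ E] in
lemma one_le_deriv_mul_norm {D : ℝ} {S : Set E} {w : E} (hD : 0 ≤ D) (hw : w ∈ S)
    (h : 1 ≤ ENNReal.ofReal D * Metric.infEDist (0 : E) S) : 1 ≤ D * ‖w‖ := by
  have h1 : Metric.infEDist (0 : E) S ≤ ENNReal.ofReal ‖w‖ := by
    refine (Metric.infEDist_le_edist_of_mem hw).trans ?_
    rw [edist_dist, dist_zero_left]
  have h2 : (1 : ENNReal) ≤ ENNReal.ofReal (D * ‖w‖) := by
    rw [ENNReal.ofReal_mul hD]
    exact h.trans (by gcongr)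
  exact ENNReal.one_le_ofReal.1 h2

lemma deriv_mul_sub_le_of_concaveOn {S : Set ℝ} {φ : ℝ → ℝ} {s s' : ℝ} (hφ : ConcaveOn ℝ S φ)
    (hs : s ∈ S) (hs' : s' ∈ S) (hle : s' ≤ s) (hd : DifferentiableAt ℝ φ s) :
    deriv φ s * (s - s') ≤ φ s - φ s' := by
  rcases hle.eq_or_lt with rfl | hlt
  · simp
  · have h := hφ.deriv_le_slope hs' hs hlt hd
    rw [slope_def_field, le_div_iff₀ (sub_pos.2 hlt)] at h
    exact h

/-- Convergence of descent sequences: a sequence with sufficient decrease and subgradients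
controlled by the step length converges to each of its accumulation points at which the
Kurdyka–Łojasiewicz property holds and whose value is the limit of the values. -/
theorem tendsto_of_klAt {g : E → EReal} {c : E} (hKL : KLAt g c) {z : ℕ → E} {r : ℕ → ℝ} {r₀ : ℝ}
    (hz : ∀ k, g (z k) = r k) (hc : g c = r₀) {a b : ℝ} (ha : 0 < a)
    (hdec : ∀ k, a * ‖z (k + 1) - z k‖ ^ 2 ≤ r k - r (k + 1)) (hr : Tendsto r atTop (𝓝 r₀))
    {w : ℕ → E} (hw : ∀ k, w k ∈ subdiff g (z (k + 1)))
    (hwb : ∀ k, ‖w k‖ ≤ b * ‖z (k + 1) - z k‖)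
    {σ : ℕ → ℕ} (hσ : StrictMono σ) (hlim : Tendsto (z ∘ σ) atTop (𝓝 c)) :
    Tendsto z atTop (𝓝 c) := by
  have hanti : Antitone r := antitone_nat_of_succ_le fun k => by
    have := hdec k
    have : 0 ≤ a * ‖z (k + 1) - z k‖ ^ 2 := by positivity
    linarith
  have hge : ∀ k, r₀ ≤ r k := fun k => hanti.le_of_tendsto hr k
  suffices h : CauchySeq z from tendsto_nhds_of_cauchySeq_of_subseq h hσ.tendsto_atTop hlim
  by_cases hfin : ∃ k, r k = r₀
  · -- once the limit value is attained, the sequence is constant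
    obtain ⟨N, hN⟩ := hfin
    have hconst : ∀ k, z (k + N) = z N := by
      intro k
      induction k with
      | zero => simp
      | succ k ih =>
        have h1 := hdec (k + N)
        have h2 : r (k + N) ≤ r N := hanti (by omega)
        have h3 := hge (k + N + 1)
        have h4 : a * ‖z (k + N + 1) - z (k + N)‖ ^ 2 ≤ 0 := by linarith
        have h5 : ‖z (k + N + 1) - z (k + N)‖ ^ 2 = 0 := by
          have := sq_nonneg ‖z (k + N + 1) - z (k + N)‖
          nlinarith
        rw [sq_eq_zero_iff, norm_eq_zero, sub_eq_zero] at h5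
        rw [show k + 1 + N = k + N + 1 by ring, h5, ih]
    have ht : Tendsto z atTop (𝓝 (z N)) := by
      rw [← tendsto_add_atTop_iff_nat N]
      simp only [hconst]
      exact tendsto_const_nhds
    exact ht.cauchySeq
  push Not at hfin
  have hpos : ∀ k, 0 < r k - r₀ := fun k => sub_pos.2 ((hge k).lt_of_ne (hfin k).symm)
  obtain ⟨η, hη, U, hU, φ, hφc, hφconc, hφnn, hφ0, hφC1, hφd, hineq⟩ := hKL
  obtain ⟨ρ, hρ, hball⟩ := Metric.mem_nhds_iff.1 hU
  -- nothing forces `b` to be nonnegative, so it is replaced by its positive part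
  set b' := max b 0 with hb'
  have hwb' : ∀ k, ‖w k‖ ≤ b' * ‖z (k + 1) - z k‖ := fun k =>
    (hwb k).trans (mul_le_mul_of_nonneg_right (le_max_left _ _) (norm_nonneg _))
  have hs0 : Tendsto (fun k => r k - r₀) atTop (𝓝 0) := by simpa using hr.sub_const r₀
  have hsη : ∀ᶠ k in atTop, ((r k - r₀ : ℝ) : EReal) < η := by
    have : Tendsto (fun k => ((r k - r₀ : ℝ) : EReal)) atTop (𝓝 ((0 : ℝ) : EReal)) :=
      (continuous_coe_real_ereal.tendsto 0).comp hs0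
    exact this.eventually (gt_mem_nhds (by simpa using hη))
  have hφlim : Tendsto (fun k => φ (r k - r₀)) atTop (𝓝 0) := by
    have h0 : ContinuousWithinAt φ {s : ℝ | 0 ≤ s ∧ (s : EReal) < η} 0 :=
      hφc 0 ⟨le_rfl, by simpa using hη⟩
    have h1 : Tendsto (fun k => r k - r₀) atTop (𝓝[{s : ℝ | 0 ≤ s ∧ (s : EReal) < η}] 0) :=
      tendsto_nhdsWithin_iff.2 ⟨hs0, hsη.mono fun k hk => ⟨(hpos k).le, hk⟩⟩
    have h2 := h0.tendsto.comp h1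
    rwa [hφ0] at h2
  have hstep : Tendsto (fun k => ‖z (k + 1) - z k‖) atTop (𝓝 0) := by
    have h1 : Tendsto (fun k => (r k - r (k + 1)) / a) atTop (𝓝 0) := by
      have := (hr.sub (hr.comp (tendsto_add_atTop_nat 1))).div_const a
      simpa using this
    have h2 : Tendsto (fun k => ‖z (k + 1) - z k‖ ^ 2) atTop (𝓝 0) :=
      squeeze_zero (fun _ => sq_nonneg _)
        (fun k => (le_div_iff₀ ha).2 (by linarith [hdec k])) h1
    have h3 := h2.sqrt
    simpa [Real.sqrt_sq] using h3
  -- a starting index from which the trapping argument applies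
  have hsmall : Tendsto (fun k => dist (z (σ k)) c +
      (‖z (σ k + 1) - z (σ k)‖ + ‖z (σ k + 1) - z (σ k)‖) + b' / a * φ (r (σ k + 1) - r₀))
      atTop (𝓝 0) := by
    have h1 := tendsto_iff_dist_tendsto_zero.1 hlim
    have h2 := hstep.comp hσ.tendsto_atTop
    have h3 := ((hφlim.comp (tendsto_add_atTop_nat 1)).comp hσ.tendsto_atTop).const_mul (b' / a)
    simpa using (h1.add (h2.add h2)).add h3
  obtain ⟨N₀, hN₀⟩ := eventually_atTop.1 hsη
  obtain ⟨j, hj1, hj2⟩ := ((hsmall.eventually (gt_mem_nhds hρ)).and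
    (hσ.tendsto_atTop.eventually (eventually_ge_atTop N₀))).exists
  set N := σ j with hN
  have hlt : ∀ k, ((r (k + N) - r₀ : ℝ) : EReal) < η := fun k => hN₀ _ (by omega)
  have hcauchy : CauchySeq fun k => z (k + N) := by
    refine cauchySeq_of_step_recursion (c := c) (ρ := ρ)
      (ψ := fun k => b' / a * φ (r (k + N) - r₀)) (fun k => ?_) (fun k hk => ?_) ?_
    · exact mul_nonneg (div_nonneg (le_max_right _ _) ha.le) (hφnn _ (hpos _).le (hlt k))
    · have hmem : ∀ i, r (i + N) - r₀ ∈ {s : ℝ | 0 ≤ s ∧ (s : EReal) < η} := fun i =>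
        ⟨(hpos _).le, hlt i⟩
      have hdiff : DifferentiableAt ℝ φ (r (k + 1 + N) - r₀) :=
        differentiableAt_of_deriv_ne_zero (hφd _ (hpos _) (hlt _)).ne'
      have hslope := deriv_mul_sub_le_of_concaveOn hφconc (hmem (k + 1)) (hmem (k + 2))
        (by have := hanti (show k + 1 + N ≤ k + 2 + N by omega); linarith) hdiff
      have hDpos := (hφd _ (hpos (k + 1 + N)) (hlt (k + 1))).le
      have hK : 1 ≤ deriv φ (r (k + 1 + N) - r₀) * ‖w (k + N)‖ := by
        have hval := hz (k + 1 + N)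
        refine one_le_deriv_mul_norm (S := subdiff g (z (k + 1 + N))) hDpos ?_ ?_
        · have := hw (k + N)
          rwa [show k + N + 1 = k + 1 + N by ring] at this
        · have := hineq (z (k + 1 + N)) (hball hk)
            (by rw [hval, hc]; exact_mod_cast sub_pos.1 (hpos _))
            (by
              rw [hval, hc]
              have h := EReal.add_lt_add_left_coe (hlt (k + 1)) r₀
              rwa [← EReal.coe_add, add_sub_cancel] at h)
          simpa only [hval, hc, EReal.toReal_coe] using this
      have hwk := hwb' (k + N)
      have hdk := hdec (k + 1 + N)
      rw [show k + 1 + N + 1 = k + 2 + N by ring] at hdk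
      rw [show k + N + 1 = k + 1 + N by ring] at hwk
      rw [dist_eq_norm, dist_eq_norm]
      exact two_mul_step_le ha (le_max_right b 0) (norm_nonneg _) hDpos
        (by linarith) hwk hK hslope
    · have h1 : dist (z (1 + N)) c ≤ ‖z (N + 1) - z N‖ + dist (z N) c := by
        rw [← dist_eq_norm, add_comm 1 N]; exact dist_triangle _ _ _
      have h2 : dist (z (1 + N)) (z (0 + N)) = ‖z (N + 1) - z N‖ := by
        rw [← dist_eq_norm, add_comm 1 N, zero_add]
      rw [h2]
      simp only [add_comm 1 N]
      rw [add_comm 1 N] at h1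
      linarith
  exact (cauchySeq_shift N).1 hcauchy

end

/-! ### First-order optimality and smoothness estimates -/

lemma exists_lipschitz_fderiv {E : Type*} [NormedAddCommGroup E] [NormedSpace ℝ E] {f : E → ℝ}
    (hf : ContDiff ℝ 2 f) {K : Set E} (hK : IsCompact K) :
    ∃ Λ : ℝ, 0 ≤ Λ ∧ ∀ x ∈ K, ∀ y ∈ K, ‖fderiv ℝ f x - fderiv ℝ f y‖ ≤ Λ * ‖x - y‖ := by
  have h1 : ContDiff ℝ 1 (fderiv ℝ f) := hf.fderiv_right (by norm_num)
  obtain ⟨Λ, hΛ⟩ := h1.locallyLipschitz.locallyLipschitzOn.exists_lipschitzOnWith_of_compact hK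
  exact ⟨Λ, Λ.2, fun x hx y hy => hΛ.norm_sub_le hx hy⟩

section

variable {E : Type*} [NormedAddCommGroup E] [InnerProductSpace ℝ E]

/-- Fermat's rule for the sum of a convex and a differentiable function; taking the convex function
to be zero on `s` gives the variational inequality for constrained minimizers. -/
lemma le_add_of_isMinOn_add {s : Set E} {f g : E → ℝ} {g' : E →L[ℝ] ℝ} {x : E}
    (hf : ConvexOn ℝ s f) (hx : x ∈ s) (hg : HasFDerivAt g g' x)
    (hmin : ∀ z ∈ s, f x + g x ≤ f z + g z) {z : E} (hz : z ∈ s) : f x ≤ f z + g' (z - x) := by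
  have hd : HasDerivAt (fun t : ℝ => g (x + t • (z - x))) (g' (z - x)) 0 := by
    have h1 : HasDerivAt (fun t : ℝ => x + t • (z - x)) (z - x) 0 := by
      simpa using ((hasDerivAt_id (0 : ℝ)).smul_const (z - x)).const_add x
    have hg0 : HasFDerivAt g g' (x + (0 : ℝ) • (z - x)) := by simpa using hg
    exact hg0.comp_hasDerivAt (0 : ℝ) h1
  have hlim := hd.tendsto_slope_zero_right
  have hev : ∀ᶠ t : ℝ in 𝓝[>] 0,
      f x - f z ≤ t⁻¹ • (g (x + (0 + t) • (z - x)) - g (x + (0 : ℝ) • (z - x))) := by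
    filter_upwards [Ioo_mem_nhdsGT (zero_lt_one (α := ℝ))] with t ht
    have hxt : x + t • (z - x) = (1 - t) • x + t • z := by
      rw [smul_sub, sub_smul, one_smul]; abel
    have hmem : x + t • (z - x) ∈ s := by
      rw [hxt]
      exact hf.1 hx hz (by linarith [ht.2]) ht.1.le (by ring)
    have h1 := hmin _ hmem
    have h2 : f (x + t • (z - x)) ≤ (1 - t) * f x + t * f z := by
      rw [hxt]
      exact hf.2 hx hz (by linarith [ht.2]) ht.1.le (by ring)
    rw [zero_add, zero_smul, add_zero, smul_eq_mul, ← div_eq_inv_mul, le_div_iff₀ ht.1]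
    linarith
  have := ge_of_tendsto hlim hev
  linarith

lemma IsConvexFun.convexOn_toReal {f : E → EReal} (hp : IsProper f)
    (hf : IsConvexFun f) : ConvexOn ℝ {x | f x ≠ ⊤} fun x => (f x).toReal := by
  have hcoe : ∀ {x}, f x ≠ ⊤ → ((f x).toReal : EReal) = f x := fun hx =>
    EReal.coe_toReal hx (hp.1 _)
  have hepi : ∀ {x}, f x ≠ ⊤ → ((x, (f x).toReal) : E × ℝ) ∈ {q : E × ℝ | f q.1 ≤ (q.2 : EReal)} :=
    fun hx => (hcoe hx).ge
  refine ⟨fun x hx y hy a b ha hb hab => ?_, fun x hx y hy a b ha hb hab => ?_⟩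
  · exact ne_top_of_le_ne_top (EReal.coe_ne_top _) (hf (hepi hx) (hepi hy) ha hb hab)
  · have h : f (a • x + b • y) ≤ ((a • (f x).toReal + b • (f y).toReal : ℝ) : EReal) :=
      hf (hepi hx) (hepi hy) ha hb hab
    have hne : f (a • x + b • y) ≠ ⊤ := ne_top_of_le_ne_top (EReal.coe_ne_top _) h
    rw [← hcoe hne] at h
    exact_mod_cast h

/-- Fermat's rule for the sum of a proper convex function and a differentiable function: minus
the derivative of the latter is a subgradient of the former. -/
lemma le_add_of_isMin_ereal {f : E → EReal} (hp : IsProper f) (hf : IsConvexFun f) {g : E → ℝ}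
    {g' : E →L[ℝ] ℝ} {x : E} (hg : HasFDerivAt g g' x)
    (hmin : ∀ z, f x + (g x : EReal) ≤ f z + (g z : EReal)) (z : E) :
    f x ≤ f z + (g' (z - x) : ℝ) := by
  have hcoe : ∀ {x}, f x ≠ ⊤ → ((f x).toReal : EReal) = f x := fun hx =>
    EReal.coe_toReal hx (hp.1 _)
  by_cases hz : f z = ⊤
  · rw [hz, EReal.top_add_coe]; exact le_top
  have hx : f x ≠ ⊤ := by
    intro h
    have := hmin z
    rw [h, EReal.top_add_coe, top_le_iff, ← hcoe hz, ← EReal.coe_add] at this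
    exact EReal.coe_ne_top _ this
  have h := le_add_of_isMinOn_add (hf.convexOn_toReal hp) hx hg (fun y hy => ?_) hz
  · rw [← hcoe hx, ← hcoe hz]
    exact_mod_cast h
  · have := hmin y
    rw [← hcoe hx, ← hcoe hy] at this
    exact_mod_cast this

/-- A descent estimate around `t`. The mean value inequality is used instead of integration along
the segment, which costs a factor `2` in the quadratic term. -/
lemma le_add_fderiv_add_mul_sq {f : E → ℝ} {s : Set E} (hs : Convex ℝ s)
    (hf : Differentiable ℝ f) {Λ : ℝ} (hΛ : 0 ≤ Λ) {t r : E} (ht : t ∈ s) (hr : r ∈ s)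
    (hlip : ∀ z ∈ s, ‖fderiv ℝ f z - fderiv ℝ f t‖ ≤ Λ * ‖z - t‖) :
    f r ≤ f t + fderiv ℝ f t (r - t) + Λ * ‖r - t‖ ^ 2 := by
  have h := Convex.norm_image_sub_le_of_norm_hasFDerivWithin_le' (𝕜 := ℝ) (f := f)
    (f' := fderiv ℝ f) (φ := fderiv ℝ f t) (C := Λ * ‖r - t‖) (x := t) (y := r)
    (s := s ∩ Metric.closedBall t ‖r - t‖)
    (fun z _ => (hf z).hasFDerivAt.hasFDerivWithinAt)
    (fun z hz => (hlip z hz.1).trans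
      (mul_le_mul_of_nonneg_left (mem_closedBall_iff_norm.1 hz.2) hΛ))
    (hs.inter (convex_closedBall _ _)) ⟨ht, by simp⟩ ⟨hr, by simp [dist_eq_norm]⟩
  have h2 := (le_abs_self _).trans h
  rw [mul_assoc, ← sq] at h2
  linarith

end

/-! ### Quadratic models -/

section

variable {E F : Type*} [NormedAddCommGroup E] [InnerProductSpace ℝ E]
  [NormedAddCommGroup F] [InnerProductSpace ℝ F]

/-- The quadratic function `⟨a, s - t⟩ + ‖G (s - t)‖² + (c / 2) ‖s - t‖²` of `s`. -/
def quadratic (a : E) (G : E →L[ℝ] F) (c : ℝ) (t s : E) : ℝ :=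
  inner ℝ a (s - t) + ‖G (s - t)‖ ^ 2 + c / 2 * ‖s - t‖ ^ 2

variable {a t s : E} {G : E →L[ℝ] F} {c : ℝ} {C : Set E}

lemma continuous_quadratic : Continuous (quadratic a G c t) := by
  unfold quadratic
  fun_prop

lemma quadratic_add_half_mul (c c' : ℝ) :
    quadratic a G (c + c') t s = quadratic a G c t s + c' / 2 * ‖s - t‖ ^ 2 := by
  unfold quadratic
  ring

/-- The variational inequality that characterizes constrained minimizers of a quadratic model. -/
lemma quadratic_variational (hC : Convex ℝ C) (hs : s ∈ C)
    (hmin : ∀ r ∈ C, quadratic a G c t s ≤ quadratic a G c t r) {r : E} (hr : r ∈ C) :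
    0 ≤ inner ℝ a (r - s) + 2 * inner ℝ (G (s - t)) (G (r - s)) + c * inner ℝ (s - t) (r - s) := by
  have h0 : HasFDerivAt (fun r : E => r - t) (ContinuousLinearMap.id ℝ E) s :=
    (hasFDerivAt_id s).sub_const t
  have h1 : HasFDerivAt (fun r => inner ℝ a (r - t)) (innerSL ℝ a) s :=
    (innerSL ℝ a).hasFDerivAt.comp s h0
  have h2 := ((G.hasFDerivAt (x := s - t)).comp s h0).norm_sq
  have h3 := (h0.norm_sq).const_mul (c / 2)
  have h := le_add_of_isMinOn_add (f := fun _ => 0) (convexOn_const (0 : ℝ) hC) hs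
    ((h1.add h2).add h3) (fun z hz => by simpa [quadratic] using hmin z hz) hr
  simp only [zero_add] at h
  convert h using 1
  simp [inner_sub_left]
  ring

lemma quadratic_minimizer_unique (hC : Convex ℝ C) (hc : 0 < c) {r : E} (hs : s ∈ C) (hr : r ∈ C)
    (hsmin : ∀ u ∈ C, quadratic a G c t s ≤ quadratic a G c t u)
    (hrmin : ∀ u ∈ C, quadratic a G c t r ≤ quadratic a G c t u) : s = r := by
  have h1 := quadratic_variational hC hs hsmin hr
  have h2 := quadratic_variational hC hr hrmin hs
  have e1 : r - t = (s - t) + (r - s) := by abel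
  have e2 : s - r = -(r - s) := by abel
  rw [e1, e2] at h2
  simp only [map_add, map_neg, inner_neg_right, inner_add_left, real_inner_self_eq_norm_sq] at h2
  have h4 : c * ‖r - s‖ ^ 2 ≤ 0 := by nlinarith [sq_nonneg ‖G (r - s)‖]
  have h5 : ‖r - s‖ ^ 2 = 0 := by
    have := sq_nonneg ‖r - s‖
    nlinarith
  rw [sq_eq_zero_iff, norm_eq_zero, sub_eq_zero] at h5
  exact h5.symm

end

/-! ### The Huber cost-to-move -/

section

variable {ι : Type*} [Fintype ι] {μ : ℝ} {α : ι → ℝ}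

lemma huber_term_nonneg (hμ : 0 < μ) (a : ℝ) :
    0 ≤ if |a| < μ then a ^ 2 / (2 * μ) else |a| - μ / 2 := by
  split_ifs with h
  · positivity
  · linarith

lemma huber_nonneg (hμ : 0 < μ) (α : ι → ℝ) : 0 ≤ huber μ α :=
  Finset.sum_nonneg fun i _ => huber_term_nonneg hμ (α i)

lemma huber_eq_of_abs_lt (h : ∀ i, |α i| < μ) : huber μ α = (∑ i, α i ^ 2) / (2 * μ) := by
  unfold huber
  rw [Finset.sum_div]
  exact Finset.sum_congr rfl fun i _ => if_pos (h i)

lemma abs_lt_of_huber_lt (hμ : 0 < μ) (h : huber μ α < μ / 2) (i : ι) : |α i| < μ := by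
  have h1 := Finset.single_le_sum (fun j _ => huber_term_nonneg hμ (α j)) (Finset.mem_univ i)
  by_contra hi
  rw [if_neg hi] at h1
  have h2 : |α i| - μ / 2 ≤ huber μ α := h1
  linarith [not_lt.1 hi]

lemma sum_abs_sub_le_huber (hμ : 0 < μ) (α : ι → ℝ) :
    ∑ i, |α i| - Fintype.card ι * (μ / 2) ≤ huber μ α := by
  have h : ∑ i, (|α i| - μ / 2) ≤ huber μ α := by
    refine Finset.sum_le_sum fun i _ => ?_
    split_ifs with h
    · rw [le_div_iff₀ (by positivity), ← sq_abs]
      nlinarith [sq_nonneg (|α i| - μ)]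
    · exact le_rfl
  simpa [Finset.sum_sub_distrib] using h

lemma sqrt_sum_sq_le_sum_abs (α : ι → ℝ) : √(∑ i, α i ^ 2) ≤ ∑ i, |α i| := by
  refine Real.sqrt_le_iff.2 ⟨Finset.sum_nonneg fun _ _ => abs_nonneg _, ?_⟩
  simpa using Finset.sum_sq_le_sq_sum_of_nonneg (s := Finset.univ) (f := fun i => |α i|)
    fun _ _ => abs_nonneg _

lemma continuous_huber (hμ : 0 < μ) : Continuous (huber μ : (ι → ℝ) → ℝ) := by
  unfold huber
  refine continuous_finsetSum _ fun i _ => ?_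
  have h : Continuous fun a : ℝ => if μ ≤ |a| then |a| - μ / 2 else a ^ 2 / (2 * μ) := by
    refine Continuous.if_le (by fun_prop) (by fun_prop) (by fun_prop) (by fun_prop) fun a ha => ?_
    rw [← sq_abs, ← ha]
    field_simp
    ring
  have h2 : Continuous fun α : ι → ℝ => α i := continuous_apply i
  convert h.comp h2 using 2 with α
  simp only [Function.comp, ← not_lt, ite_not]

end

namespace Model

variable {ℓ n m p q : ℕ} (M : Model ℓ n m p q)

/-- The rows of `W` being orthonormal, `Wᵀ` is an isometry. -/
lemma sum_sq_transpose_mulVec (hW : M.W * M.W.transpose = 1) (d : Images ℓ n) :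
    ∑ i, (M.W.transpose.mulVec fun a => d a.1 a.2) i ^ 2 = ‖d‖ ^ 2 := by
  set v : Fin (ℓ + 1) × Fin n → ℝ := fun a => d a.1 a.2 with hv
  have h1 : M.W.transpose.mulVec v ⬝ᵥ M.W.transpose.mulVec v = v ⬝ᵥ v := by
    rw [Matrix.dotProduct_mulVec, Matrix.vecMul_transpose, Matrix.mulVec_mulVec, hW,
      Matrix.one_mulVec]
  have h2 : ‖d‖ ^ 2 = v ⬝ᵥ v := by
    simp only [PiLp.norm_sq_eq_of_L2 (fun _ => EuclideanSpace ℝ (Fin n)),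
      EuclideanSpace.norm_sq_eq, Real.norm_eq_abs, sq_abs, dotProduct, Fintype.sum_prod_type, hv,
      ← sq]
  rw [h2, ← h1]
  simp only [dotProduct, sq]

lemma moveCost_nonneg (hμ : 0 < M.μ) (d : Images ℓ n) : 0 ≤ M.moveCost d :=
  huber_nonneg hμ _

lemma moveCost_of_forall_abs_lt (hW : M.W * M.W.transpose = 1) {d : Images ℓ n}
    (h : ∀ i, |(M.W.transpose.mulVec fun a => d a.1 a.2) i| < M.μ) :
    M.moveCost d = ‖d‖ ^ 2 / (2 * M.μ) := by
  rw [moveCost, huber_eq_of_abs_lt h, M.sum_sq_transpose_mulVec hW]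

lemma moveCost_of_norm_lt (hW : M.W * M.W.transpose = 1) {d : Images ℓ n} (h : ‖d‖ < M.μ) :
    M.moveCost d = ‖d‖ ^ 2 / (2 * M.μ) := by
  refine M.moveCost_of_forall_abs_lt hW fun i => lt_of_le_of_lt ?_ h
  refine abs_le_of_sq_le_sq ?_ (norm_nonneg d)
  rw [← M.sum_sq_transpose_mulVec hW d]
  exact Finset.single_le_sum
    (f := fun i => (M.W.transpose.mulVec fun a => d a.1 a.2) i ^ 2)
    (fun j _ => sq_nonneg _) (Finset.mem_univ i)

lemma moveCost_of_lt (hμ : 0 < M.μ) (hW : M.W * M.W.transpose = 1) {d : Images ℓ n}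
    (h : M.moveCost d < M.μ / 2) : M.moveCost d = ‖d‖ ^ 2 / (2 * M.μ) :=
  M.moveCost_of_forall_abs_lt hW (abs_lt_of_huber_lt hμ h)

lemma moveCost_zero (hμ : 0 < M.μ) (hW : M.W * M.W.transpose = 1) :
    M.moveCost 0 = 0 := by
  rw [M.moveCost_of_norm_lt hW (by simpa using hμ)]
  simp

lemma norm_sub_le_moveCost (hμ : 0 < M.μ) (hW : M.W * M.W.transpose = 1) (d : Images ℓ n) :
    ‖d‖ - Fintype.card (Fin (ℓ + 1) × Fin q) * (M.μ / 2) ≤ M.moveCost d := by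
  refine le_trans ?_ (sum_abs_sub_le_huber hμ _)
  gcongr
  rw [← Real.sqrt_sq (norm_nonneg d), ← M.sum_sq_transpose_mulVec hW d]
  exact sqrt_sum_sq_le_sum_abs _

lemma continuous_moveCost (hμ : 0 < M.μ) : Continuous M.moveCost := by
  refine (continuous_huber hμ).comp (Continuous.matrix_mulVec continuous_const ?_)
  fun_prop

lemma tendsto_norm_of_tendsto_moveCost (hμ : 0 < M.μ) (hW : M.W * M.W.transpose = 1)
    {d : ℕ → Images ℓ n} (h : Tendsto (fun k => M.moveCost (d k)) atTop (𝓝 0)) :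
    Tendsto (fun k => ‖d k‖) atTop (𝓝 0) := by
  have h1 : Tendsto (fun k => √(2 * M.μ * M.moveCost (d k))) atTop (𝓝 0) := by
    simpa using (h.const_mul (2 * M.μ)).sqrt
  refine h1.congr' ?_
  filter_upwards [h.eventually (gt_mem_nhds (half_pos hμ))] with k hk
  rw [M.moveCost_of_lt hμ hW hk, mul_div_cancel₀ _ (by positivity), Real.sqrt_sq (norm_nonneg _)]

end Model

namespace Model

variable {ℓ n m p q : ℕ} (M : Model ℓ n m p q)

/-! ### The boxes -/

lemma isCompact_box (j : Fin ℓ) : IsCompact (M.box j) := by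
  have h : M.box j = (EuclideanSpace.equiv (Fin p) ℝ).toHomeomorph ⁻¹'
      Set.Icc (M.lower j) (M.upper j) := by
    ext t
    simp [box, Pi.le_def, forall_and]
  rw [h]
  exact (Homeomorph.isCompact_preimage _).2 isCompact_Icc

lemma convex_box (j : Fin ℓ) : Convex ℝ (M.box j) := by
  intro s hs t ht a b ha hb hab i
  have h := (convex_Icc (M.lower j i) (M.upper j i)) (hs i) (ht i) ha hb hab
  simpa using h

lemma isCompact_constraint : IsCompact M.constraint := by
  have h : M.constraint =
      (PiLp.continuousLinearEquiv 2 ℝ fun _ : Fin ℓ => EuclideanSpace ℝ (Fin p)).toHomeomorph ⁻¹'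
        Set.univ.pi M.box := by
    ext θ
    simp [constraint]
  rw [h]
  exact (Homeomorph.isCompact_preimage _).2 (isCompact_univ_pi M.isCompact_box)

/-! ### Smoothness of the fidelity term -/

section Smooth

variable {M}

lemma contDiff_fid (hC2 : ∀ k k', ContDiff ℝ 2 (fun t => M.interp t k k')) (j : Fin ℓ) :
    ContDiff ℝ 2 fun u : Images ℓ n × EuclideanSpace ℝ (Fin p) => M.fid u.1 j u.2 := by
  unfold fid
  refine ContDiff.norm_sq ℝ (ContDiff.sub (contDiff_euclidean.2 fun i => ?_) contDiff_const)
  have h : ∀ k k', ContDiff ℝ 2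
      fun u : Images ℓ n × EuclideanSpace ℝ (Fin p) => M.interp u.2 k k' :=
    fun k k' => (hC2 k k').comp contDiff_snd
  simp only [← Matrix.mulVec_mulVec, Pi.add_apply]
  simp only [Matrix.mulVec, dotProduct]
  fun_prop

lemma contDiff_fid_right (hC2 : ∀ k k', ContDiff ℝ 2 (fun t => M.interp t k k'))
    (x : Images ℓ n) (j : Fin ℓ) : ContDiff ℝ 2 (M.fid x j) := by
  have h := (contDiff_fid hC2 j).comp (contDiff_prodMk_right x)
  exact h

lemma hasFDerivAt_fid_right (hC2 : ∀ k k', ContDiff ℝ 2 (fun t => M.interp t k k'))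
    (x : Images ℓ n) (j : Fin ℓ) (t : EuclideanSpace ℝ (Fin p)) :
    HasFDerivAt (M.fid x j)
      ((fderiv ℝ (fun u : Images ℓ n × EuclideanSpace ℝ (Fin p) => M.fid u.1 j u.2) (x, t)).comp
        (ContinuousLinearMap.inr ℝ _ _)) t :=
  HasFDerivAt.comp t ((contDiff_fid hC2 j).differentiable (by norm_num) (x, t)).hasFDerivAt
    (hasFDerivAt_prodMk_right x t)

lemma inner_gradient_fid (hC2 : ∀ k k', ContDiff ℝ 2 (fun t => M.interp t k k'))
    (x : Images ℓ n) (j : Fin ℓ) (t h : EuclideanSpace ℝ (Fin p)) :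
    inner ℝ (gradient (M.fid x j) t) h = fderiv ℝ (M.fid x j) t h := by
  have := ((contDiff_fid_right hC2 x j).differentiable (by norm_num) t).hasGradientAt
  rw [this.hasFDerivAt.fderiv]
  simp

/-- The derivative of the fidelity term in the parameters is Lipschitz continuous on the box,
uniformly in bounded images. -/
lemma exists_lipschitz_fid (hC2 : ∀ k k', ContDiff ℝ 2 (fun t => M.interp t k k'))
    (j : Fin ℓ) (R : ℝ) : ∃ Λ : ℝ, 0 ≤ Λ ∧ ∀ x : Images ℓ n, ‖x‖ ≤ R → ∀ s ∈ M.box j,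
      ∀ t ∈ M.box j, ‖fderiv ℝ (M.fid x j) s - fderiv ℝ (M.fid x j) t‖ ≤ Λ * ‖s - t‖ := by
  obtain ⟨Λ, hΛ, h⟩ := exists_lipschitz_fderiv (contDiff_fid hC2 j)
    ((isCompact_closedBall (0 : Images ℓ n) R).prod (M.isCompact_box j))
  refine ⟨Λ, hΛ, fun x hx s hs t ht => ?_⟩
  have hx' : x ∈ Metric.closedBall (0 : Images ℓ n) R := by simpa using hx
  have h1 := h (x, s) ⟨hx', hs⟩ (x, t) ⟨hx', ht⟩
  rw [(hasFDerivAt_fid_right hC2 x j s).fderiv, (hasFDerivAt_fid_right hC2 x j t).fderiv,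
    ← ContinuousLinearMap.sub_comp]
  refine (ContinuousLinearMap.opNorm_comp_le _ _).trans ?_
  refine (mul_le_of_le_one_right (norm_nonneg _)
    (ContinuousLinearMap.norm_inr_le_one ℝ _ _)).trans (h1.trans_eq ?_)
  simp [Prod.norm_def]

variable (M) in
/-- The fidelity term `‖A(θ) x - y‖²` as a function of the pair `(x, θ)`. -/
def fidelity (z : WithLp 2 (Images ℓ n × Params ℓ p)) : ℝ :=
  ‖M.sensing z.snd z.fst - M.meas‖ ^ 2

lemma fidelity_eq_sum (z : WithLp 2 (Images ℓ n × Params ℓ p)) :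
    M.fidelity z = ∑ j, M.fid z.fst j (z.snd j) := by
  rw [fidelity, PiLp.norm_sq_eq_of_L2]
  rfl

lemma contDiff_fidelity (hC2 : ∀ k k', ContDiff ℝ 2 (fun t => M.interp t k k')) :
    ContDiff ℝ 2 M.fidelity := by
  simp only [funext fidelity_eq_sum]
  refine ContDiff.sum fun j _ => ?_
  have h : ContDiff ℝ 2 fun z : WithLp 2 (Images ℓ n × Params ℓ p) => (z.fst, z.snd j) := by
    have h1 := WithLp.contDiff_ofLp (𝕜 := ℝ) (E := Images ℓ n) (F := Params ℓ p) (p := 2) (n := 2)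
    have h2 : ContDiff ℝ 2 fun θ : Params ℓ p => θ j := by fun_prop
    exact h1.fst.prodMk (h2.comp h1.snd)
  have h1 := (contDiff_fid hC2 j).comp h
  exact h1

/-- The inclusion of image displacements into the product space. -/
def inclImages (ℓ n p : ℕ) : Images ℓ n →L[ℝ] WithLp 2 (Images ℓ n × Params ℓ p) :=
  ((WithLp.prodContinuousLinearEquiv 2 ℝ (Images ℓ n) (Params ℓ p)).symm :
    Images ℓ n × Params ℓ p →L[ℝ] _).comp (ContinuousLinearMap.inl ℝ _ _)

/-- The inclusion of parameter displacements into the product space. -/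
def inclParams (ℓ n p : ℕ) : Params ℓ p →L[ℝ] WithLp 2 (Images ℓ n × Params ℓ p) :=
  ((WithLp.prodContinuousLinearEquiv 2 ℝ (Images ℓ n) (Params ℓ p)).symm :
    Images ℓ n × Params ℓ p →L[ℝ] _).comp (ContinuousLinearMap.inr ℝ _ _)

lemma inclImages_add_inclParams (h : WithLp 2 (Images ℓ n × Params ℓ p)) :
    inclImages ℓ n p h.fst + inclParams ℓ n p h.snd = h := by
  apply WithLp.ofLp_injective
  ext1 <;> simp [inclImages, inclParams]

lemma hasFDerivAt_fidelity_left (hC2 : ∀ k k', ContDiff ℝ 2 (fun t => M.interp t k k'))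
    (x : Images ℓ n) (θ : Params ℓ p) :
    HasFDerivAt (fun x => M.fidelity (WithLp.toLp 2 (x, θ)))
      ((fderiv ℝ M.fidelity (WithLp.toLp 2 (x, θ))).comp (inclImages ℓ n p)) x := by
  have h1 := ((contDiff_fidelity hC2).differentiable (by norm_num)
    (WithLp.toLp 2 (x, θ))).hasFDerivAt
  have h2 : HasFDerivAt (fun x : Images ℓ n => WithLp.toLp 2 (x, θ)) (inclImages ℓ n p) x :=
    (WithLp.prodContinuousLinearEquiv 2 ℝ (Images ℓ n) (Params ℓ p)).symm.hasFDerivAt.comp x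
      (hasFDerivAt_prodMk_left x θ)
  exact h1.comp x h2

lemma hasFDerivAt_fidelity_right (hC2 : ∀ k k', ContDiff ℝ 2 (fun t => M.interp t k k'))
    (x : Images ℓ n) (θ : Params ℓ p) :
    HasFDerivAt (fun θ => M.fidelity (WithLp.toLp 2 (x, θ)))
      ((fderiv ℝ M.fidelity (WithLp.toLp 2 (x, θ))).comp (inclParams ℓ n p)) θ := by
  have h1 := ((contDiff_fidelity hC2).differentiable (by norm_num)
    (WithLp.toLp 2 (x, θ))).hasFDerivAt
  have h2 : HasFDerivAt (fun θ : Params ℓ p => WithLp.toLp 2 (x, θ)) (inclParams ℓ n p) θ :=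
    (WithLp.prodContinuousLinearEquiv 2 ℝ (Images ℓ n) (Params ℓ p)).symm.hasFDerivAt.comp θ
      (hasFDerivAt_prodMk_right x θ)
  have h := h1.comp θ h2
  exact h

lemma fderiv_fidelity_inclParams (hC2 : ∀ k k', ContDiff ℝ 2 (fun t => M.interp t k k'))
    (x : Images ℓ n) (θ h : Params ℓ p) :
    fderiv ℝ M.fidelity (WithLp.toLp 2 (x, θ)) (inclParams ℓ n p h) =
      ∑ j, inner ℝ (gradient (M.fid x j) (θ j)) (h j) := by
  have hline : ∀ {V : Type} [NormedAddCommGroup V] [NormedSpace ℝ V] (u v : V),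
      HasDerivAt (fun s : ℝ => u + s • v) v 0 := fun u v => by
    simpa using ((hasDerivAt_id (0 : ℝ)).smul_const v).const_add u
  have h1 : HasDerivAt (fun s : ℝ => M.fidelity (WithLp.toLp 2 (x, θ + s • h)))
      (fderiv ℝ M.fidelity (WithLp.toLp 2 (x, θ)) (inclParams ℓ n p h)) 0 := by
    have h0 : HasFDerivAt (fun θ => M.fidelity (WithLp.toLp 2 (x, θ)))
      ((fderiv ℝ M.fidelity (WithLp.toLp 2 (x, θ))).comp (inclParams ℓ n p))
        (θ + (0 : ℝ) • h) := by
      simpa using hasFDerivAt_fidelity_right hC2 x θ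
    exact h0.comp_hasDerivAt (0 : ℝ) (hline θ h)
  have h2 : HasDerivAt (fun s : ℝ => ∑ j, M.fid x j (θ j + s • h j))
      (∑ j, inner ℝ (gradient (M.fid x j) (θ j)) (h j)) 0 := by
    refine HasDerivAt.fun_sum fun j _ => ?_
    rw [inner_gradient_fid hC2]
    have h0 : HasFDerivAt (M.fid x j) (fderiv ℝ (M.fid x j) (θ j)) (θ j + (0 : ℝ) • h j) := by
      simpa using ((contDiff_fid_right hC2 x j).differentiable (by norm_num) (θ j)).hasFDerivAt
    exact h0.comp_hasDerivAt (0 : ℝ) (hline (θ j) (h j))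
  have h3 : (fun s : ℝ => M.fidelity (WithLp.toLp 2 (x, θ + s • h))) =
      fun s : ℝ => ∑ j, M.fid x j (θ j + s • h j) := funext fun s => fidelity_eq_sum _
  rw [h3] at h1
  exact h1.unique h2

end Smooth

/-! ### The quadratic models of the second step -/

/-- The linear map `A_j J(t)`, the Jacobian of the `j`-th residual in the parameters. -/
def residualJac (x : Images ℓ n) (j : Fin ℓ) (t : EuclideanSpace ℝ (Fin p)) :
    EuclideanSpace ℝ (Fin p) →L[ℝ] EuclideanSpace ℝ (Fin m) :=
  LinearMap.toContinuousLinearMap (Matrix.toEuclideanLin (M.sens j * M.jac x t))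

lemma quadModel_eq_quadratic (x : Images ℓ n) (j : Fin ℓ) (t : EuclideanSpace ℝ (Fin p)) (c : ℝ)
    (s : EuclideanSpace ℝ (Fin p)) : M.quadModel x j t c s =
      quadratic (gradient (M.fid x j) t) (M.residualJac x j t) c t s := by
  have h1 : ∀ v : EuclideanSpace ℝ (Fin p), v.ofLp ⬝ᵥ v.ofLp = ‖v‖ ^ 2 := fun v => by
    simp [EuclideanSpace.norm_sq_eq, dotProduct, ← sq]
  have h2 : ∀ v : EuclideanSpace ℝ (Fin p), v.ofLp ⬝ᵥ
      ((M.sens j * M.jac x t).transpose * (M.sens j * M.jac x t)).mulVec v.ofLp =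
        ‖M.residualJac x j t v‖ ^ 2 := fun v => by
    rw [← Matrix.mulVec_mulVec, Matrix.dotProduct_mulVec, Matrix.vecMul_transpose]
    simp [residualJac, EuclideanSpace.norm_sq_eq, dotProduct, ← sq, Matrix.toLpLin_apply]
  rw [quadModel, quadratic, hess, Matrix.add_mulVec, dotProduct_add, Matrix.smul_mulVec,
    Matrix.smul_mulVec, Matrix.one_mulVec, dotProduct_smul, dotProduct_smul, h1, h2, smul_eq_mul,
    smul_eq_mul]
  ring

lemma continuous_residualJac (hC2 : ∀ k k', ContDiff ℝ 2 (fun t => M.interp t k k')) (j : Fin ℓ) :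
    Continuous fun u : Images ℓ n × EuclideanSpace ℝ (Fin p) => M.residualJac u.1 j u.2 := by
  have h1 : Continuous fun A : Matrix (Fin m) (Fin p) ℝ =>
      LinearMap.toContinuousLinearMap (Matrix.toEuclideanLin A) :=
    (LinearMap.toContinuousLinearMap.toLinearMap.comp
      (Matrix.toEuclideanLin (𝕜 := ℝ) (m := Fin m) (n := Fin p)).toLinearMap
      ).continuous_of_finiteDimensional
  refine h1.comp (Continuous.matrix_mul continuous_const (continuous_matrix fun k i => ?_))
  have h2 : ∀ k k', Continuous
      fun u : Images ℓ n × EuclideanSpace ℝ (Fin p) => fderiv ℝ (fun s => M.interp s k k') u.2 :=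
    fun k k' => ((hC2 k k').continuous_fderiv (by norm_num)).comp continuous_snd
  simp only [jac, interpDeriv, Matrix.mulVec, dotProduct, Matrix.of_apply]
  fun_prop

lemma exists_norm_residualJac_le (hC2 : ∀ k k', ContDiff ℝ 2 (fun t => M.interp t k k'))
    (j : Fin ℓ) (R : ℝ) : ∃ B : ℝ, ∀ x : Images ℓ n, ‖x‖ ≤ R → ∀ t ∈ M.box j,
      ‖M.residualJac x j t‖ ≤ B := by
  obtain ⟨B, hB⟩ := ((isCompact_closedBall (0 : Images ℓ n) R).prod
    (M.isCompact_box j)).exists_bound_of_continuousOn (M.continuous_residualJac hC2 j).continuousOn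
  exact ⟨B, fun x hx t ht => hB (x, t) ⟨by simpa using hx, ht⟩⟩

end Model

namespace Model

variable {ℓ n m p q : ℕ} {M : Model ℓ n m p q}

/-! ### The second step -/

lemma exists_isTrial {lam : ℝ} {x : Images ℓ n} {j : Fin ℓ} {t : EuclideanSpace ℝ (Fin p)}
    (ht : t ∈ M.box j) (i : ℕ) : ∃ s, M.IsTrial lam x j t i s := by
  obtain ⟨s, hs, hmin⟩ := (M.isCompact_box j).exists_isMinOn ⟨t, ht⟩
    (continuous_quadratic (a := gradient (M.fid x j) t) (G := M.residualJac x j t)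
      (c := 2 ^ i * lam) (t := t)).continuousOn
  refine ⟨s, hs, fun r hr => ?_⟩
  rw [quadModel_eq_quadratic, quadModel_eq_quadratic]
  exact hmin hr

section Trial

variable {lam : ℝ} {x : Images ℓ n} {j : Fin ℓ} {t s : EuclideanSpace ℝ (Fin p)} {i : ℕ}

lemma IsTrial.quadratic_le (h : M.IsTrial lam x j t i s) : ∀ r ∈ M.box j,
    quadratic (gradient (M.fid x j) t) (M.residualJac x j t) (2 ^ i * lam) t s ≤
      quadratic (gradient (M.fid x j) t) (M.residualJac x j t) (2 ^ i * lam) t r := fun r hr => by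
  rw [← quadModel_eq_quadratic, ← quadModel_eq_quadratic]
  exact h.2 r hr

lemma existsUnique_isTrial (hlam : 0 < lam) (ht : t ∈ M.box j) (i : ℕ) :
    ∃! s, M.IsTrial lam x j t i s := by
  obtain ⟨s, hs⟩ := exists_isTrial (lam := lam) (x := x) ht i
  exact ⟨s, hs, fun r hr => quadratic_minimizer_unique (M.convex_box j)
    (mul_pos (by positivity) hlam) hr.1 hs.1 hr.quadratic_le hs.quadratic_le⟩

/-- Passing from the coefficient `2 ^ i` to `2 ^ i - 1` leaves a decrease proportional to the
squared step. -/
lemma fid_add_le_of_isAccepted (ht : t ∈ M.box j) (h : M.IsTrial lam x j t i s)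
    (ha : M.IsAccepted lam x j t i s) : M.fid x j s + lam / 2 * ‖s - t‖ ^ 2 ≤ M.fid x j t := by
  have h1 := h.quadratic_le t ht
  have h2 : quadratic (gradient (M.fid x j) t) (M.residualJac x j t) (2 ^ i * lam) t t = 0 := by
    simp [quadratic]
  have h3 := quadratic_add_half_mul (a := gradient (M.fid x j) t) (G := M.residualJac x j t)
    (t := t) (s := s) ((2 ^ i - 1) * lam) lam
  rw [show (2 ^ i - 1) * lam + lam = 2 ^ i * lam by ring] at h3
  rw [IsAccepted, quadModel_eq_quadratic] at ha
  linarith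

/-- The sufficient-decrease test is passed as soon as the proximal coefficient dominates a
constant that depends only on a bound for the images. -/
lemma exists_forall_isAccepted (hC2 : ∀ k k', ContDiff ℝ 2 (fun t => M.interp t k k'))
    (j : Fin ℓ) (R : ℝ) : ∃ Λ : ℝ, 0 ≤ Λ ∧ ∀ (lam : ℝ) (x : Images ℓ n), ‖x‖ ≤ R →
      ∀ t ∈ M.box j, ∀ s ∈ M.box j, ∀ i : ℕ, Λ ≤ (2 ^ i - 1) * lam / 2 →
        M.IsAccepted lam x j t i s := by
  obtain ⟨Λ, hΛ, h⟩ := exists_lipschitz_fid hC2 j R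
  refine ⟨Λ, hΛ, fun lam x hx t ht s hs i hi => ?_⟩
  have h1 := le_add_fderiv_add_mul_sq (M.convex_box j)
    ((contDiff_fid_right hC2 x j).differentiable (by norm_num)) hΛ ht hs
    fun z hz => h x hx z hz t ht
  rw [IsAccepted, quadModel_eq_quadratic, quadratic, inner_gradient_fid hC2]
  have h2 := mul_le_mul_of_nonneg_right hi (sq_nonneg ‖s - t‖)
  have h3 := sq_nonneg ‖M.residualJac x j t (s - t)‖
  linarith

lemma exists_isAccepted (hC2 : ∀ k k', ContDiff ℝ 2 (fun t => M.interp t k k'))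
    (hlam : 0 < lam) (x : Images ℓ n) (ht : t ∈ M.box j) :
    ∃ i : ℕ, 1 ≤ i ∧ ∃ s, M.IsTrial lam x j t i s ∧ M.IsAccepted lam x j t i s := by
  obtain ⟨Λ, -, h⟩ := exists_forall_isAccepted hC2 j ‖x‖
  obtain ⟨i, hi⟩ := pow_unbounded_of_one_lt (2 * Λ / lam + 1) (one_lt_two (α := ℝ))
  obtain ⟨s, hs⟩ := exists_isTrial (lam := lam) (x := x) ht (i + 1)
  refine ⟨i + 1, by omega, s, hs, h lam x le_rfl t ht s hs.1 _ ?_⟩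
  have h1 : (2 : ℝ) ^ i ≤ 2 ^ (i + 1) := pow_le_pow_right₀ one_le_two (by omega)
  have h2 : 2 * Λ / lam < 2 ^ (i + 1) - 1 := by linarith
  rw [div_lt_iff₀ hlam] at h2
  linarith

lemma exists_isStepTwo (hC2 : ∀ k k', ContDiff ℝ 2 (fun t => M.interp t k k'))
    (hlam : 0 < lam) (x : Images ℓ n) (ht : t ∈ M.box j) : ∃ s, M.IsStepTwo lam x j t s := by
  classical
  have h := exists_isAccepted hC2 hlam x ht
  obtain ⟨h1, s, hs⟩ := Nat.find_spec h
  exact ⟨s, Nat.find h, ⟨⟨h1, s, hs⟩, fun i hi => Nat.find_min' h hi⟩, hs⟩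

/-- Minimality of the index bounds the proximal coefficient: the previous index is rejected. -/
lemma exists_isStepTwo_bound (hC2 : ∀ k k', ContDiff ℝ 2 (fun t => M.interp t k k'))
    (j : Fin ℓ) (R : ℝ) : ∃ B : ℝ, ∀ x : Images ℓ n, ‖x‖ ≤ R →
      ∀ t ∈ M.box j, ∀ s, M.IsStepTwo lam x j t s →
        ∃ i : ℕ, 2 ^ i * lam ≤ B ∧ M.IsTrial lam x j t i s ∧ M.IsAccepted lam x j t i s := by
  obtain ⟨Λ, hΛ, h⟩ := exists_forall_isAccepted hC2 j R
  refine ⟨4 * Λ + 2 * lam, fun x hx t ht s hs => ?_⟩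
  obtain ⟨i, hi, hst⟩ := hs
  refine ⟨i, ?_, hst⟩
  by_contra! hbig
  obtain ⟨k, rfl⟩ : ∃ k, i = k + 1 := ⟨i - 1, by have := hi.1.1; omega⟩
  rw [pow_succ] at hbig
  have hk : 1 ≤ k := by
    rcases Nat.eq_zero_or_pos k with rfl | hk
    · norm_num at hbig
      linarith
    · exact hk
  obtain ⟨r, hr⟩ := exists_isTrial (lam := lam) (x := x) ht k
  have := hi.2 ⟨hk, r, hr, h lam x hx t ht r hr.1 k (by linarith)⟩
  omega

end Trial

/-! ### The first step -/

lemma obj_of_mem {θ : Params ℓ p} (hθ : θ ∈ M.constraint) (x : Images ℓ n) :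
    M.obj x θ = M.prior x + ((M.κ * M.fidelity (WithLp.toLp 2 (x, θ)) : ℝ) : EReal) := by
  rw [obj, if_pos hθ, add_zero]
  rfl

lemma isStepOne_iff {lam : ℝ} {x x' : Images ℓ n} {θ : Params ℓ p} (hθ : θ ∈ M.constraint) :
    M.IsStepOne lam x θ x' ↔ ∀ z,
      M.prior x' + ((M.κ * M.fidelity (WithLp.toLp 2 (x', θ)) +
        lam / 2 * M.moveCost (x' - x) : ℝ) : EReal) ≤
      M.prior z + ((M.κ * M.fidelity (WithLp.toLp 2 (z, θ)) +
        lam / 2 * M.moveCost (z - x) : ℝ) : EReal) := by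
  simp only [IsStepOne, obj_of_mem hθ, EReal.coe_add, add_assoc]

lemma continuous_fidelity_left (hC2 : ∀ k k', ContDiff ℝ 2 (fun t => M.interp t k k'))
    (θ : Params ℓ p) : Continuous fun x => M.fidelity (WithLp.toLp 2 (x, θ)) :=
  (contDiff_fidelity hC2).continuous.comp (by fun_prop)

lemma lowerSemicontinuous_prior_add (hp : IsProper M.prior) (hf : LowerSemicontinuous M.prior)
    {g : Images ℓ n → ℝ} (hg : Continuous g) :
    LowerSemicontinuous fun x => M.prior x + (g x : EReal) := by
  refine hf.add' (continuous_coe_real_ereal.comp hg).lowerSemicontinuous fun x => ?_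
  exact EReal.continuousAt_add (.inr (EReal.coe_ne_bot _)) (.inl (hp.1 x))

lemma exists_isStepOne (hμ : 0 < M.μ) (hp : IsProper M.prior)
    (hf : LowerSemicontinuous M.prior) (hbelow : ∃ c : ℝ, ∀ x θ, (c : EReal) ≤ M.obj x θ)
    (hC2 : ∀ k k', ContDiff ℝ 2 (fun t => M.interp t k k'))
    (hW : M.W * M.W.transpose = 1) {lam : ℝ} (hlam : 0 < lam) (x : Images ℓ n)
    {θ : Params ℓ p} (hθ : θ ∈ M.constraint) : ∃ x', M.IsStepOne lam x θ x' := by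
  obtain ⟨c, hc⟩ := hbelow
  obtain ⟨x₀, hx₀⟩ := hp.2
  have hx₀' : ((M.prior x₀).toReal : EReal) = M.prior x₀ := EReal.coe_toReal hx₀ (hp.1 _)
  obtain ⟨g, hg⟩ : ∃ g : Images ℓ n → ℝ, g = fun z =>
    M.κ * M.fidelity (WithLp.toLp 2 (z, θ)) + lam / 2 * M.moveCost (z - x) := ⟨_, rfl⟩
  have hgc : Continuous g := hg ▸ ((continuous_fidelity_left hC2 θ).const_mul _).add
    (((M.continuous_moveCost hμ).comp (continuous_id.sub continuous_const)).const_mul _)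
  set r : ℝ := (M.prior x₀).toReal + g x₀ with hr
  set N : ℝ := Fintype.card (Fin (ℓ + 1) × Fin q) * (M.μ / 2) with hN
  -- outside the ball of radius `R` the cost-to-move alone exceeds `r - c`
  set R : ℝ := max ‖x₀ - x‖ (2 * (r - c) / lam + N) with hR
  have hx₀K : x₀ ∈ Metric.closedBall x R := by
    rw [mem_closedBall_iff_norm]; exact le_max_left _ _
  obtain ⟨x', hx', hmin⟩ := LowerSemicontinuousOn.exists_isMinOn ⟨x₀, hx₀K⟩
    (isCompact_closedBall x R) ((lowerSemicontinuous_prior_add hp hf hgc).lowerSemicontinuousOn _)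
  refine ⟨x', (isStepOne_iff hθ).2 fun z => ?_⟩
  suffices h : M.prior x' + (g x' : EReal) ≤ M.prior z + (g z : EReal) by simpa only [hg] using h
  by_cases hz : z ∈ Metric.closedBall x R
  · exact hmin hz
  refine (hmin hx₀K).trans ?_
  have h1 : M.prior x₀ + (g x₀ : EReal) = (r : ℝ) := by rw [hr, EReal.coe_add, hx₀']
  have h2 : r ≤ c + lam / 2 * M.moveCost (z - x) := by
    rw [mem_closedBall_iff_norm, not_le] at hz
    have h3 := (le_max_right _ _).trans_lt hz
    have h4 := M.norm_sub_le_moveCost hμ hW (z - x)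
    have h5 : 2 * (r - c) / lam < M.moveCost (z - x) := by linarith
    rw [div_lt_iff₀ hlam] at h5
    linarith
  have h3 := hc z θ
  rw [obj_of_mem hθ] at h3
  calc M.prior x₀ + (g x₀ : EReal) ≤ ((c + lam / 2 * M.moveCost (z - x) : ℝ) : EReal) := by
        rw [h1]; exact_mod_cast h2
    _ ≤ _ := by
        rw [hg, EReal.coe_add, EReal.coe_add, ← add_assoc]
        exact add_le_add h3 le_rfl

/-! ### Existence of runs and sufficient decrease -/

lemma exists_isRun {lamX : ℕ → ℝ} {lamT : ℝ}
    (h₁ : ∀ (k : ℕ) (x : Images ℓ n), ∀ θ ∈ M.constraint, ∃ x', M.IsStepOne (lamX k) x θ x')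
    (h₂ : ∀ (x : Images ℓ n) (j : Fin ℓ), ∀ t ∈ M.box j, ∃ s, M.IsStepTwo lamT x j t s)
    {θ₀ : Params ℓ p} (hθ₀ : θ₀ ∈ M.constraint) :
    ∃ x θ, θ 0 = θ₀ ∧ M.IsRun lamX lamT x θ := by
  have hstep : ∀ (k : ℕ) (u : Images ℓ n × M.constraint), ∃ u' : Images ℓ n × M.constraint,
      M.IsStepOne (lamX k) u.1 u.2 u'.1 ∧
        ∀ j, M.IsStepTwo lamT u'.1 j (u.2.1 j) (u'.2.1 j) := by
    rintro k ⟨x, θ, hθ⟩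
    obtain ⟨x', hx'⟩ := h₁ k x θ hθ
    choose s hs using fun j => h₂ x' j (θ j) (hθ j)
    refine ⟨(x', ⟨WithLp.toLp 2 s, fun j => ?_⟩), hx', hs⟩
    obtain ⟨i, -, h, -⟩ := hs j
    exact h.1
  choose next hnext using hstep
  let u : ℕ → Images ℓ n × M.constraint := fun k => Nat.rec (0, ⟨θ₀, hθ₀⟩) next k
  exact ⟨fun k => (u k).1, fun k => (u k).2, rfl, rfl, hθ₀, fun k => (hnext k (u k)).1,
    fun k => (hnext k (u k)).2⟩

section Run

variable {lamX : ℕ → ℝ} {lamT : ℝ} {x : ℕ → Images ℓ n} {θ : ℕ → Params ℓ p}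

lemma IsRun.mem_constraint (h : M.IsRun lamX lamT x θ) (k : ℕ) : θ k ∈ M.constraint := by
  cases k with
  | zero => exact h.init_θ
  | succ k =>
    intro j
    obtain ⟨i, -, hi, -⟩ := h.step_two k j
    exact hi.1

lemma IsRun.fidelity_add_le (h : M.IsRun lamX lamT x θ) (k : ℕ) :
    M.fidelity (WithLp.toLp 2 (x (k + 1), θ (k + 1))) + lamT / 2 * ‖θ (k + 1) - θ k‖ ^ 2 ≤
      M.fidelity (WithLp.toLp 2 (x (k + 1), θ k)) := by
  rw [fidelity_eq_sum, fidelity_eq_sum, PiLp.norm_sq_eq_of_L2, Finset.mul_sum,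
    ← Finset.sum_add_distrib]
  refine Finset.sum_le_sum fun j _ => ?_
  obtain ⟨i, -, hi, hi'⟩ := h.step_two k j
  exact fid_add_le_of_isAccepted (h.mem_constraint k j) hi hi'

lemma IsRun.obj_succ_add_le (h : M.IsRun lamX lamT x θ) (hκ : 0 < M.κ) (hμ : 0 < M.μ)
    (hW : M.W * M.W.transpose = 1) {lamMin : ℝ} (hX : ∀ k, lamMin ≤ lamX k) (hT : lamMin ≤ lamT)
    (k : ℕ) : M.obj (x (k + 1)) (θ (k + 1)) +
      ((lamMin / 2 * (M.κ * ‖θ (k + 1) - θ k‖ ^ 2 + M.moveCost (x (k + 1) - x k)) : ℝ) : EReal)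
        ≤ M.obj (x k) (θ k) := by
  have h1 := (isStepOne_iff (h.mem_constraint k)).1 (h.step_one k) (x k)
  rw [sub_self, M.moveCost_zero hμ hW, mul_zero, add_zero, ← obj_of_mem (h.mem_constraint k)] at h1
  refine le_trans ?_ h1
  rw [obj_of_mem (h.mem_constraint (k + 1)), add_assoc, ← EReal.coe_add]
  refine add_le_add le_rfl (EReal.coe_le_coe_iff.2 ?_)
  have h2 := mul_le_mul_of_nonneg_left (h.fidelity_add_le k) hκ.le
  have h3 := mul_le_mul_of_nonneg_right (hX k) (M.moveCost_nonneg hμ (x (k + 1) - x k))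
  have h4 : lamMin * (M.κ * ‖θ (k + 1) - θ k‖ ^ 2) ≤ lamT * (M.κ * ‖θ (k + 1) - θ k‖ ^ 2) :=
    mul_le_mul_of_nonneg_right hT (by positivity)
  linarith

/-- From the first iterate on, the objective is finite along a run. -/
lemma IsRun.prior_ne_top (h : M.IsRun lamX lamT x θ) (hp : IsProper M.prior) (k : ℕ) :
    M.prior (x (k + 1)) ≠ ⊤ := by
  obtain ⟨x₀, hx₀⟩ := hp.2
  intro htop
  have h1 := (isStepOne_iff (h.mem_constraint k)).1 (h.step_one k) x₀
  rw [htop, EReal.top_add_coe, top_le_iff] at h1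
  exact EReal.add_ne_top hx₀ (EReal.coe_ne_top _) h1

/-- The real-valued objective of the iterates of a run, meaningful from the first one on. -/
def value (M : Model ℓ n m p q) (x : ℕ → Images ℓ n) (θ : ℕ → Params ℓ p) (k : ℕ) : ℝ :=
  (M.prior (x k)).toReal + M.κ * M.fidelity (WithLp.toLp 2 (x k, θ k))

lemma IsRun.obj_eq_value (h : M.IsRun lamX lamT x θ) (hp : IsProper M.prior) (k : ℕ) :
    M.obj (x (k + 1)) (θ (k + 1)) = (M.value x θ (k + 1) : EReal) := by
  rw [obj_of_mem (h.mem_constraint _), value, EReal.coe_add,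
    EReal.coe_toReal (h.prior_ne_top hp k) (hp.1 _)]

lemma IsRun.value_succ_add_le (h : M.IsRun lamX lamT x θ) (hκ : 0 < M.κ) (hμ : 0 < M.μ)
    (hp : IsProper M.prior) (hW : M.W * M.W.transpose = 1) {lamMin : ℝ}
    (hX : ∀ k, lamMin ≤ lamX k) (hT : lamMin ≤ lamT) (k : ℕ) :
    M.value x θ (k + 2) + lamMin / 2 * (M.κ * ‖θ (k + 2) - θ (k + 1)‖ ^ 2 +
      M.moveCost (x (k + 2) - x (k + 1))) ≤ M.value x θ (k + 1) := by
  have h1 := h.obj_succ_add_le hκ hμ hW hX hT (k + 1)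
  rw [h.obj_eq_value hp, h.obj_eq_value hp] at h1
  exact_mod_cast h1

/-- The objective values of a run converge, being nonincreasing and bounded below. -/
lemma IsRun.exists_tendsto_value (h : M.IsRun lamX lamT x θ) (hκ : 0 < M.κ) (hμ : 0 < M.μ)
    (hp : IsProper M.prior) (hbelow : ∃ c : ℝ, ∀ x θ, (c : EReal) ≤ M.obj x θ)
    (hW : M.W * M.W.transpose = 1) {lamMin : ℝ}
    (hmin : 0 < lamMin) (hX : ∀ k, lamMin ≤ lamX k) (hT : lamMin ≤ lamT) :
    ∃ v, Tendsto (M.value x θ) atTop (𝓝 v) := by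
  obtain ⟨c, hc⟩ := hbelow
  have hanti : Antitone fun k => M.value x θ (k + 1) := antitone_nat_of_succ_le fun k => by
    have h1 := h.value_succ_add_le hκ hμ hp hW hX hT k
    have h2 := M.moveCost_nonneg hμ (x (k + 2) - x (k + 1))
    have h3 : 0 ≤ lamMin / 2 * (M.κ * ‖θ (k + 2) - θ (k + 1)‖ ^ 2 +
      M.moveCost (x (k + 2) - x (k + 1))) := by positivity
    show M.value x θ (k + 2) ≤ _
    linarith
  have hbdd : BddBelow (Set.range fun k => M.value x θ (k + 1)) := by
    refine ⟨c, ?_⟩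
    rintro _ ⟨k, rfl⟩
    have := hc (x (k + 1)) (θ (k + 1))
    rw [h.obj_eq_value hp] at this
    exact_mod_cast this
  exact ⟨_, (tendsto_add_atTop_iff_nat 1).1 (tendsto_atTop_ciInf hanti hbdd)⟩

lemma IsRun.tendsto_steps (h : M.IsRun lamX lamT x θ) (hκ : 0 < M.κ) (hμ : 0 < M.μ)
    (hp : IsProper M.prior) (hbelow : ∃ c : ℝ, ∀ x θ, (c : EReal) ≤ M.obj x θ)
    (hW : M.W * M.W.transpose = 1) {lamMin : ℝ}
    (hmin : 0 < lamMin) (hX : ∀ k, lamMin ≤ lamX k) (hT : lamMin ≤ lamT) :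
    Tendsto (fun k => ‖x (k + 1) - x k‖) atTop (𝓝 0) ∧
      Tendsto (fun k => ‖θ (k + 1) - θ k‖) atTop (𝓝 0) := by
  obtain ⟨v, hv⟩ := h.exists_tendsto_value hκ hμ hp hbelow hW hmin hX hT
  have hdiff : Tendsto (fun k => (M.value x θ (k + 1) - M.value x θ (k + 2)) / (lamMin / 2))
      atTop (𝓝 0) := by
    have h1 := ((hv.comp (tendsto_add_atTop_nat 1)).sub
      (hv.comp (tendsto_add_atTop_nat 2))).div_const (lamMin / 2)
    simpa using h1
  have hle : ∀ k, M.κ * ‖θ (k + 2) - θ (k + 1)‖ ^ 2 + M.moveCost (x (k + 2) - x (k + 1)) ≤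
      (M.value x θ (k + 1) - M.value x θ (k + 2)) / (lamMin / 2) := fun k => by
    rw [le_div_iff₀ (by positivity)]
    linarith [h.value_succ_add_le hκ hμ hp hW hX hT k]
  constructor
  · refine (tendsto_add_atTop_iff_nat 1).1 ?_
    refine M.tendsto_norm_of_tendsto_moveCost hμ hW
      (squeeze_zero (fun k => M.moveCost_nonneg hμ _) (fun k => (hle k).trans' ?_) hdiff)
    exact le_add_of_nonneg_left (by positivity)
  · refine (tendsto_add_atTop_iff_nat 1).1 ?_
    have h1 : Tendsto (fun k => M.κ * ‖θ (k + 2) - θ (k + 1)‖ ^ 2) atTop (𝓝 0) :=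
      squeeze_zero (fun k => by positivity) (fun k => (hle k).trans'
        (le_add_of_nonneg_right (M.moveCost_nonneg hμ _))) hdiff
    have h2 := (h1.const_mul M.κ⁻¹).sqrt
    simpa [← mul_assoc, inv_mul_cancel₀ hκ.ne', Real.sqrt_sq] using h2

end Run

end Model

lemma inner_gradient {E : Type*} [NormedAddCommGroup E] [InnerProductSpace ℝ E] [CompleteSpace E]
    (f : E → ℝ) (z v : E) : inner ℝ (gradient f z) v = fderiv ℝ f z v :=
  InnerProductSpace.toDual_symm_apply

lemma frechetSubdiff_subset_subdiff {E : Type*} [NormedAddCommGroup E] [InnerProductSpace ℝ E]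
    (g : E → EReal) (z : E) : frechetSubdiff g z ⊆ subdiff g z := fun v hv =>
  ⟨hv.1, fun _ => z, fun _ => v, tendsto_const_nhds, tendsto_const_nhds, fun _ => hv,
    tendsto_const_nhds⟩

namespace Model

variable {ℓ n m p q : ℕ} {M : Model ℓ n m p q}

/-! ### Subgradients of the objective produced by the algorithm -/

/-- Near the origin the cost-to-move is quadratic, hence differentiable. -/
lemma hasFDerivAt_moveCost (hW : M.W * M.W.transpose = 1) {x x' : Images ℓ n}
    (hx : ‖x' - x‖ < M.μ) :
    HasFDerivAt (fun z => M.moveCost (z - x)) ((1 / M.μ) • innerSL ℝ (x' - x)) x' := by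
  have h0 : HasFDerivAt (fun z : Images ℓ n => z - x) (ContinuousLinearMap.id ℝ _) x' :=
    (hasFDerivAt_id x').sub_const x
  have h1 := h0.norm_sq.mul_const (1 / (2 * M.μ))
  have h2 : HasFDerivAt (fun z => ‖z - x‖ ^ 2 * (1 / (2 * M.μ)))
      ((1 / M.μ) • innerSL ℝ (x' - x)) x' := by
    refine h1.congr_fderiv ?_
    ext v
    simp
    ring
  refine h2.congr_of_eventuallyEq ?_
  have hc : ContinuousAt (fun z : Images ℓ n => ‖z - x‖) x' := by fun_prop
  filter_upwards [hc.eventually (gt_mem_nhds hx)] with z hz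
  rw [M.moveCost_of_norm_lt hW hz]
  ring

/-- Optimality in the first step: a subgradient of the prior. -/
lemma IsStepOne.prior_le (hp : IsProper M.prior) (hf : IsConvexFun M.prior)
    (hC2 : ∀ k k', ContDiff ℝ 2 (fun t => M.interp t k k')) (hW : M.W * M.W.transpose = 1)
    {lam : ℝ} {x x' : Images ℓ n} {θ : Params ℓ p} (hθ : θ ∈ M.constraint)
    (h : M.IsStepOne lam x θ x') (hx : ‖x' - x‖ < M.μ) (z : Images ℓ n) :
    M.prior x' ≤ M.prior z + ((M.κ * fderiv ℝ M.fidelity (WithLp.toLp 2 (x', θ))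
      (inclImages ℓ n p (z - x')) + lam / (2 * M.μ) * inner ℝ (x' - x) (z - x') : ℝ) : EReal) := by
  have h1 := ((hasFDerivAt_fidelity_left hC2 x' θ).const_mul M.κ).add
    ((hasFDerivAt_moveCost hW hx).const_mul (lam / 2))
  have h2 := le_add_of_isMin_ereal hp hf h1 ((isStepOne_iff hθ).1 h) z
  convert h2 using 3
  simp [inner_sub_left]
  ring

/-- Optimality in the second step: minus the sum of `ν` and the gradient of the fidelity term in the
parameters is normal to the constraint set at `θ'`, and `ν` is controlled by the step length. -/
lemma exists_normal (hC2 : ∀ k k', ContDiff ℝ 2 (fun t => M.interp t k k')) {lamT : ℝ}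
    (hlam : 0 < lamT) (R : ℝ) : ∃ B : ℝ, 0 ≤ B ∧ ∀ x : Images ℓ n, ‖x‖ ≤ R →
      ∀ θ ∈ M.constraint, ∀ θ' : Params ℓ p, (∀ j, M.IsStepTwo lamT x j (θ j) (θ' j)) →
        ∃ ν : Params ℓ p, ‖ν‖ ≤ B * ‖θ' - θ‖ ∧ ∀ η ∈ M.constraint,
          0 ≤ fderiv ℝ M.fidelity (WithLp.toLp 2 (x, θ)) (inclParams ℓ n p (η - θ')) +
            inner ℝ ν (η - θ') := by
  choose B₁ hB₁ using fun j => exists_isStepTwo_bound (M := M) hC2 (lam := lamT) j R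
  choose B₂ hB₂ using fun j => M.exists_norm_residualJac_le hC2 j R
  set b : Fin ℓ → ℝ := fun j => |2 * B₂ j ^ 2| + |B₁ j| with hb
  have hb0 : ∀ j, 0 ≤ b j := fun j => by positivity
  refine ⟨∑ j, b j, Finset.sum_nonneg fun j _ => hb0 j, fun x hx θ hθ θ' hθ' => ?_⟩
  choose i hi using fun j => hB₁ j x hx (θ j) (hθ j) (θ' j) (hθ' j)
  let G := fun j => M.residualJac x j (θ j)
  let d := fun j => θ' j - θ j
  let ν : Params ℓ p := WithLp.toLp 2 fun j =>
    (2 : ℝ) • (G j).adjoint (G j (d j)) + (2 ^ i j * lamT) • d j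
  have hν : ∀ j, ‖ν j‖ ≤ (∑ j, b j) * ‖d j‖ := fun j => by
    have h1 : ‖(2 : ℝ) • (G j).adjoint (G j (d j))‖ ≤ 2 * B₂ j ^ 2 * ‖d j‖ := by
      have hG := hB₂ j x hx (θ j) (hθ j)
      have h2 : ‖(G j).adjoint (G j (d j))‖ ≤ ‖G j‖ * (‖G j‖ * ‖d j‖) := by
        refine ((G j).adjoint.le_opNorm _).trans ?_
        rw [LinearIsometryEquiv.norm_map]
        exact mul_le_mul_of_nonneg_left ((G j).le_opNorm _) (norm_nonneg _)
      have h3 : ‖G j‖ * ‖G j‖ ≤ B₂ j * B₂ j := mul_self_le_mul_self (norm_nonneg _) hG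
      rw [norm_smul, Real.norm_of_nonneg zero_le_two]
      have h4 := mul_le_mul_of_nonneg_right h3 (norm_nonneg (d j))
      linarith
    have h2 : ‖(2 ^ i j * lamT) • d j‖ ≤ B₁ j * ‖d j‖ := by
      rw [norm_smul, Real.norm_of_nonneg (by positivity)]
      exact mul_le_mul_of_nonneg_right (hi j).1 (norm_nonneg _)
    calc ‖ν j‖ ≤ 2 * B₂ j ^ 2 * ‖d j‖ + B₁ j * ‖d j‖ := (norm_add_le _ _).trans (add_le_add h1 h2)
      _ ≤ b j * ‖d j‖ := by
        rw [← add_mul]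
        exact mul_le_mul_of_nonneg_right (add_le_add (le_abs_self _) (le_abs_self _))
          (norm_nonneg _)
      _ ≤ _ := mul_le_mul_of_nonneg_right
        (Finset.single_le_sum (fun j _ => hb0 j) (Finset.mem_univ j)) (norm_nonneg _)
  refine ⟨ν, ?_, fun η hη => ?_⟩
  · refine abs_le_of_sq_le_sq' ?_ (mul_nonneg (Finset.sum_nonneg fun j _ => hb0 j)
      (norm_nonneg _)) |>.2
    rw [mul_pow, PiLp.norm_sq_eq_of_L2, PiLp.norm_sq_eq_of_L2, Finset.mul_sum]
    refine Finset.sum_le_sum fun j _ => ?_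
    rw [← mul_pow]
    exact pow_le_pow_left₀ (norm_nonneg _) (hν j) 2
  · rw [fderiv_fidelity_inclParams hC2, PiLp.inner_apply, ← Finset.sum_add_distrib]
    refine Finset.sum_nonneg fun j _ => ?_
    have h1 := quadratic_variational (M.convex_box j) (hi j).2.1.1 (hi j).2.1.quadratic_le (hη j)
    have h2 : inner ℝ (ν j) ((η - θ') j) = 2 * inner ℝ (G j (d j)) (G j (η j - θ' j)) +
        2 ^ i j * lamT * inner ℝ (d j) (η j - θ' j) := by
      show inner ℝ ((2 : ℝ) • (G j).adjoint (G j (d j)) + (2 ^ i j * lamT) • d j) (η j - θ' j) = _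
      rw [inner_add_left, real_inner_smul_left, real_inner_smul_left,
        ContinuousLinearMap.adjoint_inner_left]
    rw [h2, ← add_assoc]
    exact h1

lemma objPair_eq_top {z : WithLp 2 (Images ℓ n × Params ℓ p)} (hp : IsProper M.prior)
    (hz : z.snd ∉ M.constraint) : M.objPair z = ⊤ := by
  rw [objPair, obj, if_neg hz, EReal.add_top_of_ne_bot]
  exact fun h => (EReal.add_eq_bot_iff.1 h).elim (hp.1 _) (EReal.coe_ne_bot _)

/-- The optimality conditions of both steps combine into a Fréchet subgradient of the objective.
The gradients of the fidelity term are evaluated at the new images, once with the new and once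
with the old parameters. -/
lemma mem_frechetSubdiff (hκ : 0 < M.κ) (hp : IsProper M.prior) (hf : IsConvexFun M.prior)
    (hC2 : ∀ k k', ContDiff ℝ 2 (fun t => M.interp t k k')) (hW : M.W * M.W.transpose = 1)
    {lam : ℝ} {x x' : Images ℓ n} {θ θ' ν : Params ℓ p} (hθ : θ ∈ M.constraint)
    (hθ' : θ' ∈ M.constraint) (hx' : M.prior x' ≠ ⊤)
    (h : M.IsStepOne lam x θ x') (hx : ‖x' - x‖ < M.μ)
    (hν : ∀ η ∈ M.constraint,
      0 ≤ fderiv ℝ M.fidelity (WithLp.toLp 2 (x', θ)) (inclParams ℓ n p (η - θ')) +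
        inner ℝ ν (η - θ')) :
    M.κ • (gradient M.fidelity (WithLp.toLp 2 (x', θ')) -
        gradient M.fidelity (WithLp.toLp 2 (x', θ))) -
      WithLp.toLp 2 ((lam / (2 * M.μ)) • (x' - x), M.κ • ν) ∈
        frechetSubdiff M.objPair (WithLp.toLp 2 (x', θ')) := by
  have hdiff : Differentiable ℝ M.fidelity := (contDiff_fidelity hC2).differentiable (by norm_num)
  set z' : WithLp 2 (Images ℓ n × Params ℓ p) := WithLp.toLp 2 (x', θ') with hz'
  have hobj : M.objPair z' = M.prior x' + ((M.κ * M.fidelity z' : ℝ) : EReal) := obj_of_mem hθ' x'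
  refine ⟨?_, fun ε hε => ?_⟩
  · rw [hobj]
    exact EReal.add_ne_top hx' (EReal.coe_ne_top _)
  filter_upwards [(hdiff z').hasFDerivAt.isLittleO.def (div_pos hε hκ)] with z hz
  by_cases hzC : z.snd ∈ M.constraint
  swap
  · rw [objPair_eq_top hp hzC]
    exact le_top
  have h1 := h.prior_le hp hf hC2 hW hθ hx z.fst
  have h2 := hν z.snd hzC
  have h3 : M.κ * (M.fidelity z - M.fidelity z' - fderiv ℝ M.fidelity z' (z - z')) ≥
      -(ε * ‖z - z'‖) := by
    have h4 := mul_le_mul_of_nonneg_left ((neg_le_abs _).trans hz) hκ.le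
    rw [← mul_assoc, mul_div_cancel₀ _ hκ.ne'] at h4
    linarith
  have h5 : fderiv ℝ M.fidelity (WithLp.toLp 2 (x', θ)) (z - z') =
      fderiv ℝ M.fidelity (WithLp.toLp 2 (x', θ)) (inclImages ℓ n p (z.fst - x')) +
      fderiv ℝ M.fidelity (WithLp.toLp 2 (x', θ)) (inclParams ℓ n p (z.snd - θ')) := by
    rw [← map_add]
    exact congrArg _ (inclImages_add_inclParams (z - z')).symm
  have hobjz : M.objPair z = M.prior z.fst + ((M.κ * M.fidelity z : ℝ) : EReal) :=
    obj_of_mem hzC z.fst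
  rw [hobj, hobjz, inner_sub_left, real_inner_smul_left, inner_sub_left, inner_gradient,
    inner_gradient,
    WithLp.prod_inner_apply]
  set r := M.κ * M.fidelity z' with hr
  have h6 : inner ℝ ((lam / (2 * M.μ)) • (x' - x)) (z - z').ofLp.1 =
      lam / (2 * M.μ) * inner ℝ (x' - x) (z.fst - x') := real_inner_smul_left _ _ _
  have h7 : inner ℝ (M.κ • ν) (z - z').ofLp.2 = M.κ * inner ℝ ν (z.snd - θ') :=
    real_inner_smul_left _ _ _
  have h8 := mul_nonneg hκ.le h2
  refine (add_le_add (add_le_add h1 le_rfl) le_rfl).trans ?_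
  rw [add_assoc, add_assoc, ← EReal.coe_add, ← EReal.coe_add]
  refine add_le_add le_rfl (EReal.coe_le_coe_iff.2 ?_)
  rw [h6, h7, h5]
  linarith

end Model

namespace Model

variable {ℓ n m p q : ℕ} {M : Model ℓ n m p q}

lemma norm_toLp_le (a : Images ℓ n) (b : Params ℓ p) :
    ‖(WithLp.toLp 2 (a, b) : WithLp 2 (Images ℓ n × Params ℓ p))‖ ≤ ‖a‖ + ‖b‖ := by
  refine abs_le_of_sq_le_sq' ?_ (by positivity) |>.2
  rw [WithLp.prod_norm_sq_eq_of_L2]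
  have h1 := norm_nonneg a
  have h2 := norm_nonneg b
  show ‖a‖ ^ 2 + ‖b‖ ^ 2 ≤ _
  nlinarith

lemma norm_le_norm_toLp (a : Images ℓ n) (b : Params ℓ p) :
    ‖a‖ ≤ ‖(WithLp.toLp 2 (a, b) : WithLp 2 (Images ℓ n × Params ℓ p))‖ ∧
    ‖b‖ ≤ ‖(WithLp.toLp 2 (a, b) : WithLp 2 (Images ℓ n × Params ℓ p))‖ :=
  ⟨WithLp.norm_fst_le (p := 2) _ (WithLp.toLp 2 (a, b)),
    WithLp.norm_snd_le (p := 2) _ (WithLp.toLp 2 (a, b))⟩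

/-- The relative error estimate: for bounded images, each short iteration produces a Fréchet
subgradient of the objective whose norm is proportional to the length of the step. -/
lemma exists_subgradient_bound (hκ : 0 < M.κ) (hμ : 0 < M.μ) (hp : IsProper M.prior)
    (hf : IsConvexFun M.prior)
    (hC2 : ∀ k k', ContDiff ℝ 2 (fun t => M.interp t k k')) (hW : M.W * M.W.transpose = 1)
    {lamT lamMax : ℝ} (hlamT : 0 < lamT) (R : ℝ) :
    ∃ b : ℝ, ∀ lam, 0 ≤ lam → lam ≤ lamMax → ∀ (x x' : Images ℓ n) (θ θ' : Params ℓ p), ‖x'‖ ≤ R →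
      θ ∈ M.constraint → θ' ∈ M.constraint → M.prior x' ≠ ⊤ → M.IsStepOne lam x θ x' →
      ‖x' - x‖ < M.μ → (∀ j, M.IsStepTwo lamT x' j (θ j) (θ' j)) →
      ∃ w ∈ frechetSubdiff M.objPair (WithLp.toLp 2 (x', θ')), ‖w‖ ≤
        b * ‖(WithLp.toLp 2 (x', θ') : WithLp 2 (Images ℓ n × Params ℓ p)) -
          WithLp.toLp 2 (x, θ)‖ := by
  obtain ⟨B, hB, hnormal⟩ := exists_normal (M := M) hC2 hlamT R
  have hK : IsCompact ((WithLp.toLp 2 : _ → WithLp 2 (Images ℓ n × Params ℓ p)) ''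
      (Metric.closedBall (0 : Images ℓ n) R ×ˢ M.constraint)) :=
    ((isCompact_closedBall _ _).prod M.isCompact_constraint).image (by fun_prop)
  obtain ⟨Λ, hΛ, hlip⟩ := exists_lipschitz_fderiv (contDiff_fidelity hC2) hK
  refine ⟨M.κ * Λ + lamMax / (2 * M.μ) + M.κ * B, ?_⟩
  intro lam hlam hlam' x x' θ θ' hx' hθ hθ' htop h₁ hshort h₂
  obtain ⟨ν, hν, hvar⟩ := hnormal x' hx' θ hθ θ' h₂
  refine ⟨_, mem_frechetSubdiff hκ hp hf hC2 hW hθ hθ' htop h₁ hshort hvar, ?_⟩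
  have hx'' : x' ∈ Metric.closedBall (0 : Images ℓ n) R := by simpa using hx'
  obtain ⟨hd1, hd2⟩ := norm_le_norm_toLp (x' - x) (θ' - θ)
  have hD : (WithLp.toLp 2 (x', θ') : WithLp 2 (Images ℓ n × Params ℓ p)) -
    WithLp.toLp 2 (x, θ) = WithLp.toLp 2 (x' - x, θ' - θ) := rfl
  rw [hD]
  set D := ‖(WithLp.toLp 2 (x' - x, θ' - θ) : WithLp 2 (Images ℓ n × Params ℓ p))‖
  have h1 : ‖gradient M.fidelity (WithLp.toLp 2 (x', θ')) -
      gradient M.fidelity (WithLp.toLp 2 (x', θ))‖ ≤ Λ * D := by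
    rw [gradient, gradient, ← map_sub, LinearIsometryEquiv.norm_map]
    refine (hlip _ ⟨(x', θ'), ⟨hx'', hθ'⟩, rfl⟩ _ ⟨(x', θ), ⟨hx'', hθ⟩, rfl⟩).trans ?_
    refine mul_le_mul_of_nonneg_left ?_ hΛ
    have h2 : (WithLp.toLp 2 (x', θ') : WithLp 2 (Images ℓ n × Params ℓ p)) -
      WithLp.toLp 2 (x', θ) = WithLp.toLp 2 (x' - x', θ' - θ) := rfl
    rw [h2, sub_self]
    exact (norm_toLp_le _ _).trans (by simpa using hd2)
  have h2 : ‖(lam / (2 * M.μ)) • (x' - x)‖ ≤ lamMax / (2 * M.μ) * D := by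
    rw [norm_smul, Real.norm_of_nonneg (by positivity)]
    have := hlam.trans hlam'
    gcongr
  have h3 : ‖M.κ • ν‖ ≤ M.κ * B * D := by
    rw [norm_smul, Real.norm_of_nonneg hκ.le, mul_assoc]
    exact mul_le_mul_of_nonneg_left (hν.trans (mul_le_mul_of_nonneg_left hd2 hB)) hκ.le
  have h4 : ‖M.κ • (gradient M.fidelity (WithLp.toLp 2 (x', θ')) -
      gradient M.fidelity (WithLp.toLp 2 (x', θ)))‖ ≤ M.κ * Λ * D := by
    rw [norm_smul, Real.norm_of_nonneg hκ.le, mul_assoc]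
    exact mul_le_mul_of_nonneg_left h1 hκ.le
  have h5 := norm_toLp_le ((lam / (2 * M.μ)) • (x' - x)) (M.κ • ν)
  refine (norm_sub_le _ _).trans ?_
  linarith

/-! ### Limit points of a run -/

section Run

variable {lamX : ℕ → ℝ} {lamT : ℝ} {x : ℕ → Images ℓ n} {θ : ℕ → Params ℓ p}

/-- Along a run with vanishing steps, the objective at an accumulation point is the limit of the
objective values. Lower semicontinuity of the prior gives one inequality; comparing the iterates
with the accumulation point in the first step gives the other. -/
lemma IsRun.objPair_eq_of_tendsto (h : M.IsRun lamX lamT x θ) (hκ : 0 < M.κ) (hμ : 0 < M.μ)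
    (hp : IsProper M.prior) (hf : LowerSemicontinuous M.prior)
    (hC2 : ∀ k k', ContDiff ℝ 2 (fun t => M.interp t k k')) (hW : M.W * M.W.transpose = 1)
    {lamMax : ℝ} (hX : ∀ k, 0 ≤ lamX k ∧ lamX k ≤ lamMax) (hT : 0 ≤ lamT)
    (hsx : Tendsto (fun k => ‖x (k + 1) - x k‖) atTop (𝓝 0))
    (hsθ : Tendsto (fun k => ‖θ (k + 1) - θ k‖) atTop (𝓝 0))
    {v : ℝ} (hv : Tendsto (M.value x θ) atTop (𝓝 v)) {σ : ℕ → ℕ} (hσ : Tendsto σ atTop atTop)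
    {xs : Images ℓ n} {θs : Params ℓ p} (hxs : Tendsto (fun j => x (σ j)) atTop (𝓝 xs))
    (hθs : Tendsto (fun j => θ (σ j)) atTop (𝓝 θs)) :
    M.objPair (WithLp.toLp 2 (xs, θs)) = v := by
  have hx1 : Tendsto (fun j => x (σ j + 1)) atTop (𝓝 xs) := by
    have h1 := (tendsto_zero_iff_norm_tendsto_zero.2 hsx).comp hσ
    simpa using h1.add hxs
  have hθ1 : Tendsto (fun j => θ (σ j + 1)) atTop (𝓝 θs) := by
    have h1 := (tendsto_zero_iff_norm_tendsto_zero.2 hsθ).comp hσ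
    simpa using h1.add hθs
  have hθC : θs ∈ M.constraint := M.isCompact_constraint.isClosed.mem_of_tendsto hθs
    (Eventually.of_forall fun j => h.mem_constraint _)
  have hfid : ∀ {u : ℕ → Images ℓ n} {η : ℕ → Params ℓ p}, Tendsto u atTop (𝓝 xs) →
      Tendsto η atTop (𝓝 θs) → Tendsto (fun j => M.κ * M.fidelity (WithLp.toLp 2 (u j, η j))) atTop
        (𝓝 (M.κ * M.fidelity (WithLp.toLp 2 (xs, θs)))) := fun hu hη => by
    have hc : Continuous fun u : Images ℓ n × Params ℓ p => M.fidelity (WithLp.toLp 2 u) :=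
      (contDiff_fidelity hC2).continuous.comp (by fun_prop)
    exact ((hc.tendsto (xs, θs)).comp (hu.prodMk_nhds hη)).const_mul _
  set D := M.κ * M.fidelity (WithLp.toLp 2 (xs, θs)) with hD
  have hv1 : Tendsto (fun j => M.value x θ (σ j + 1)) atTop (𝓝 v) :=
    (hv.comp (tendsto_add_atTop_nat 1)).comp hσ
  have hprior : ∀ j, M.prior (x (σ j + 1)) = ((M.value x θ (σ j + 1) -
      M.κ * M.fidelity (WithLp.toLp 2 (x (σ j + 1), θ (σ j + 1))) : ℝ) : EReal) := fun j => by
    rw [value, add_sub_cancel_right, EReal.coe_toReal (h.prior_ne_top hp _) (hp.1 _)]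
  have hlow : M.prior xs ≤ ((v - D : ℝ) : EReal) := by
    have hlim : Tendsto (fun j => M.prior (x (σ j + 1))) atTop (𝓝 ((v - D : ℝ) : EReal)) := by
      simp only [hprior]
      exact (continuous_coe_real_ereal.tendsto _).comp (hv1.sub (hfid hx1 hθ1))
    by_contra! hlt
    obtain ⟨a, ha1, ha2⟩ := exists_between hlt
    obtain ⟨j, hj1, hj2⟩ := ((hx1.eventually (hf xs a ha2)).and
      (hlim.eventually (gt_mem_nhds ha1))).exists
    exact lt_asymm hj1 hj2
  have hne : M.prior xs ≠ ⊤ := ne_top_of_le_ne_top (EReal.coe_ne_top _) hlow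
  obtain ⟨f₀, hf₀⟩ : ∃ f₀ : ℝ, M.prior xs = f₀ := ⟨_, (EReal.coe_toReal hne (hp.1 _)).symm⟩
  rw [hf₀, EReal.coe_le_coe_iff] at hlow
  have hup : v ≤ f₀ + D := by
    have hle : ∀ j, M.value x θ (σ j + 1) ≤ f₀ + (M.κ * M.fidelity (WithLp.toLp 2 (xs, θ (σ j))) +
        lamMax / 2 * M.moveCost (xs - x (σ j))) := fun j => by
      have h1 := (isStepOne_iff (h.mem_constraint _)).1 (h.step_one (σ j)) xs
      rw [hf₀, ← EReal.coe_toReal (h.prior_ne_top hp _) (hp.1 _), ← EReal.coe_add,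
        ← EReal.coe_add, EReal.coe_le_coe_iff] at h1
      have h2 := mul_le_mul_of_nonneg_left (h.fidelity_add_le (σ j)) hκ.le
      have h3 := mul_le_mul_of_nonneg_right (hX (σ j)).2 (M.moveCost_nonneg hμ (xs - x (σ j)))
      have h4 : 0 ≤ M.κ * (lamT / 2 * ‖θ (σ j + 1) - θ (σ j)‖ ^ 2) := by positivity
      have h5 := mul_nonneg (hX (σ j)).1 (M.moveCost_nonneg hμ (x (σ j + 1) - x (σ j)))
      rw [value]
      linarith
    have hm : Tendsto (fun j => M.moveCost (xs - x (σ j))) atTop (𝓝 0) := by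
      have h1 := ((M.continuous_moveCost hμ).tendsto 0).comp
        (by simpa using hxs.const_sub xs : Tendsto (fun j => xs - x (σ j)) atTop (𝓝 0))
      rwa [M.moveCost_zero hμ hW] at h1
    have hlim := ((hfid tendsto_const_nhds hθs).add (hm.const_mul (lamMax / 2))).const_add f₀
    rw [mul_zero, add_zero] at hlim
    exact le_of_tendsto_of_tendsto' hv1 hlim hle
  have heq : v = f₀ + D := by linarith
  rw [heq, EReal.coe_add, ← hf₀]
  exact obj_of_mem hθC xs

/-- A bounded run converges to a critical point under the Kurdyka–Łojasiewicz property. -/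
theorem IsRun.exists_tendsto_isCritical (h : M.IsRun lamX lamT x θ) (hκ : 0 < M.κ) (hμ : 0 < M.μ)
    (hp : IsProper M.prior) (hf : LowerSemicontinuous M.prior) (hconv : IsConvexFun M.prior)
    (hbelow : ∃ c : ℝ, ∀ x θ, (c : EReal) ≤ M.obj x θ)
    (hC2 : ∀ k k', ContDiff ℝ 2 (fun t => M.interp t k k')) (hW : M.W * M.W.transpose = 1)
    {lamMin lamMax : ℝ} (hmin : 0 < lamMin) (hX : ∀ k, lamMin ≤ lamX k ∧ lamX k ≤ lamMax)
    (hT : lamMin ≤ lamT) (hKL : HasKL M.objPair) (hbdd : Bornology.IsBounded (Set.range x)) :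
    ∃ xs θs, Tendsto x atTop (𝓝 xs) ∧ Tendsto θ atTop (𝓝 θs) ∧
      IsCritical M.objPair (WithLp.toLp 2 (xs, θs)) := by
  obtain ⟨v, hv⟩ := h.exists_tendsto_value hκ hμ hp hbelow hW hmin (fun k => (hX k).1) hT
  obtain ⟨hsx, hsθ⟩ := h.tendsto_steps hκ hμ hp hbelow hW hmin (fun k => (hX k).1) hT
  obtain ⟨R, hR⟩ := hbdd.subset_closedBall 0
  have hxR : ∀ k, x k ∈ Metric.closedBall 0 R := fun k => hR ⟨k, rfl⟩
  -- from the index `N` on, the steps are in the quadratic regime of the Huber function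
  obtain ⟨N, hN⟩ := eventually_atTop.1 (hsx.eventually (gt_mem_nhds hμ))
  obtain ⟨⟨xs, θs⟩, -, σ, hσ, hlim⟩ :=
    ((isCompact_closedBall (0 : Images ℓ n) R).prod M.isCompact_constraint).tendsto_subseq
      (x := fun k => (x (k + (N + 1)), θ (k + (N + 1)))) fun k => ⟨hxR _, h.mem_constraint _⟩
  have hxs : Tendsto (fun j => x (σ j + (N + 1))) atTop (𝓝 xs) :=
    (continuous_fst.tendsto _).comp hlim
  have hθs : Tendsto (fun j => θ (σ j + (N + 1))) atTop (𝓝 θs) :=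
    (continuous_snd.tendsto _).comp hlim
  have hval := h.objPair_eq_of_tendsto hκ hμ hp hf hC2 hW
    (fun k => ⟨hmin.le.trans (hX k).1, (hX k).2⟩) (hmin.le.trans hT)
    hsx hsθ hv
    ((tendsto_add_atTop_nat (N + 1)).comp hσ.tendsto_atTop) hxs hθs
  set zs : WithLp 2 (Images ℓ n × Params ℓ p) := WithLp.toLp 2 (xs, θs) with hzs
  let z : ℕ → WithLp 2 (Images ℓ n × Params ℓ p) := fun k =>
    WithLp.toLp 2 (x (k + (N + 1)), θ (k + (N + 1)))
  have htoLp : Continuous (WithLp.toLp 2 : _ → WithLp 2 (Images ℓ n × Params ℓ p)) := by fun_prop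
  have hzlim : Tendsto (z ∘ σ) atTop (𝓝 zs) := (htoLp.tendsto (xs, θs)).comp hlim
  have hzval : ∀ k, M.objPair (z k) = (M.value x θ (k + (N + 1)) : EReal) := fun k =>
    h.obj_eq_value hp (k + N)
  have hvlim : Tendsto (fun k => M.value x θ (k + (N + 1))) atTop (𝓝 v) :=
    hv.comp (tendsto_add_atTop_nat (N + 1))
  obtain ⟨b, hb⟩ := exists_subgradient_bound (lamMax := lamMax) hκ hμ hp hconv hC2 hW
    (hmin.trans_le hT) R
  have hsub : ∀ k, ∃ w ∈ frechetSubdiff M.objPair (z (k + 1)),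
      ‖w‖ ≤ b * ‖z (k + 1) - z k‖ := fun k => by
    have := hb (lamX (k + (N + 1))) (hmin.le.trans (hX _).1) (hX _).2 (x (k + (N + 1)))
      (x (k + (N + 1) + 1)) (θ (k + (N + 1))) (θ (k + (N + 1) + 1)) (by simpa using hxR _)
      (h.mem_constraint _) (h.mem_constraint _) (h.prior_ne_top hp _) (h.step_one _)
      (hN _ (by omega)) (h.step_two _)
    rwa [show k + (N + 1) + 1 = k + 1 + (N + 1) by omega] at this
  choose w hw hwb using hsub
  have hdist : ∀ k, ‖z (k + 1) - z k‖ ^ 2 = ‖x (k + 1 + (N + 1)) - x (k + (N + 1))‖ ^ 2 +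
      ‖θ (k + 1 + (N + 1)) - θ (k + (N + 1))‖ ^ 2 := fun k => WithLp.prod_norm_sq_eq_of_L2 _
  have hzstep : Tendsto (fun k => ‖z (k + 1) - z k‖) atTop (𝓝 0) := by
    have h1 := (hsx.add hsθ).comp (tendsto_add_atTop_nat (N + 1))
    rw [add_zero] at h1
    refine squeeze_zero (fun _ => norm_nonneg _) (fun k => ?_) h1
    have h2 := norm_toLp_le (x (k + (N + 1) + 1) - x (k + (N + 1)))
      (θ (k + (N + 1) + 1) - θ (k + (N + 1)))
    have h3 : z (k + 1) - z k = WithLp.toLp 2 (x (k + (N + 1) + 1) - x (k + (N + 1)),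
        θ (k + (N + 1) + 1) - θ (k + (N + 1))) := by
      rw [show k + (N + 1) + 1 = k + 1 + (N + 1) by omega]; rfl
    rw [h3]
    exact h2
  have hcrit : (0 : WithLp 2 (Images ℓ n × Params ℓ p)) ∈ subdiff M.objPair zs := by
    have hw0 : Tendsto w atTop (𝓝 0) := by
      rw [tendsto_zero_iff_norm_tendsto_zero]
      exact squeeze_zero (fun _ => norm_nonneg _) hwb (by simpa using hzstep.const_mul b)
    have hz1 : Tendsto (fun j => z (σ j + 1)) atTop (𝓝 zs) := by
      have h1 := (tendsto_zero_iff_norm_tendsto_zero.2 hzstep).comp hσ.tendsto_atTop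
      simpa using h1.add hzlim
    refine ⟨hval ▸ EReal.coe_ne_top _, fun j => z (σ j + 1), fun j => w (σ j), hz1, ?_,
      fun j => hw _, hw0.comp hσ.tendsto_atTop⟩
    rw [hval]
    simp only [hzval]
    exact (continuous_coe_real_ereal.tendsto v).comp
      ((hvlim.comp (tendsto_add_atTop_nat 1)).comp hσ.tendsto_atTop)
  have hconvz : Tendsto z atTop (𝓝 zs) := by
    refine tendsto_of_klAt (hKL zs ⟨0, hcrit⟩) hzval hval
      (a := lamMin / 2 * min M.κ (1 / (2 * M.μ))) (by positivity) (fun k => ?_) hvlim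
      (fun k => frechetSubdiff_subset_subdiff _ _ (hw k)) hwb hσ hzlim
    have h1 := h.value_succ_add_le hκ hμ hp hW (fun k => (hX k).1) hT (k + N)
    rw [M.moveCost_of_norm_lt hW (hN _ (by omega)), show k + N + 2 = k + 1 + (N + 1) by omega,
      show k + N + 1 = k + (N + 1) by omega] at h1
    rw [hdist]
    have h2 := mul_le_mul_of_nonneg_right (min_le_left M.κ (1 / (2 * M.μ)))
      (sq_nonneg ‖θ (k + 1 + (N + 1)) - θ (k + (N + 1))‖)
    have h3 := mul_le_mul_of_nonneg_right (min_le_right M.κ (1 / (2 * M.μ)))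
      (sq_nonneg ‖x (k + 1 + (N + 1)) - x (k + (N + 1))‖)
    rw [one_div_mul_eq_div] at h3
    have h4 := mul_le_mul_of_nonneg_left (add_le_add h2 h3) (half_pos hmin).le
    rw [mul_assoc]
    linarith
  have hofLp : Continuous (WithLp.ofLp : WithLp 2 (Images ℓ n × Params ℓ p) → _) := by fun_prop
  have hpair := (hofLp.tendsto zs).comp hconvz
  exact ⟨xs, θs, (tendsto_add_atTop_iff_nat (N + 1)).1 ((continuous_fst.tendsto _).comp hpair),
    (tendsto_add_atTop_iff_nat (N + 1)).1 ((continuous_snd.tendsto _).comp hpair), hcrit⟩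

end Run

end Model

end MultiView

end

theorem theorem1 {ℓ n m p q : ℕ} (M : MultiView.Model ℓ n m p q)
    (hκ : 0 < M.κ) (hμ : 0 < M.μ)
    (hbox : ∀ j i, M.lower j i ≤ M.upper j i)
    (hf_proper : MultiView.IsProper M.prior)
    (hf_lsc : LowerSemicontinuous M.prior)
    (hf_convex : MultiView.IsConvexFun M.prior)
    (hbelow : ∃ c : ℝ, ∀ x θ, (c : EReal) ≤ M.obj x θ)
    (hC2 : ∀ k k', ContDiff ℝ 2 (fun t => M.interp t k k'))
    (hW : M.W * M.W.transpose = 1)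
    (lamMin lamMax : ℝ) (hmin : 0 < lamMin)
    (lamX : ℕ → ℝ) (hlamX : ∀ k, lamMin ≤ lamX k ∧ lamX k ≤ lamMax)
    (lamT : ℝ) (hlamT : lamMin ≤ lamT ∧ lamT ≤ lamMax) :
    -- the algorithm is well defined: each of its steps can be carried out from every state
    (∀ (k : ℕ) (x : MultiView.Images ℓ n), ∀ θ ∈ M.constraint,
      ∃ x', M.IsStepOne (lamX k) x θ x') ∧
    (∀ (x : MultiView.Images ℓ n) (j : Fin ℓ), ∀ t ∈ M.box j,
      (∀ i : ℕ, 1 ≤ i → ∃! s, M.IsTrial lamT x j t i s) ∧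
      (∃ i : ℕ, 1 ≤ i ∧ ∃ s, M.IsTrial lamT x j t i s ∧ M.IsAccepted lamT x j t i s)) ∧
    (∀ θ₀ ∈ M.constraint, ∃ x θ, θ 0 = θ₀ ∧ M.IsRun lamX lamT x θ) ∧
    -- and every sequence that it generates has the following properties
    (∀ (x : ℕ → MultiView.Images ℓ n) (θ : ℕ → MultiView.Params ℓ p), M.IsRun lamX lamT x θ →
      (∀ k, M.obj (x (k + 1)) (θ (k + 1)) +
          ((lamMin / 2 * (M.κ * ‖θ (k + 1) - θ k‖ ^ 2 + M.moveCost (x (k + 1) - x k)) : ℝ) : EReal)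
        ≤ M.obj (x k) (θ k)) ∧
      Filter.Tendsto (fun k => ‖x (k + 1) - x k‖ + ‖θ (k + 1) - θ k‖) Filter.atTop (nhds 0) ∧
      (MultiView.HasKL M.objPair → Bornology.IsBounded (Set.range x) →
        ∃ xs θs, Filter.Tendsto x Filter.atTop (nhds xs) ∧
          Filter.Tendsto θ Filter.atTop (nhds θs) ∧
          MultiView.IsCritical M.objPair (WithLp.toLp 2 (xs, θs)))) := by
  have hT : 0 < lamT := hmin.trans_le hlamT.1
  have h₁ : ∀ (k : ℕ) (x : MultiView.Images ℓ n), ∀ θ ∈ M.constraint,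
      ∃ x', M.IsStepOne (lamX k) x θ x' := fun k x θ hθ =>
    MultiView.Model.exists_isStepOne hμ hf_proper hf_lsc hbelow hC2 hW
      (hmin.trans_le (hlamX k).1) x hθ
  refine ⟨h₁, fun x j t ht => ⟨fun i _ => MultiView.Model.existsUnique_isTrial hT ht i,
    MultiView.Model.exists_isAccepted hC2 hT x ht⟩, fun θ₀ hθ₀ => MultiView.Model.exists_isRun h₁
      (fun x j t ht => MultiView.Model.exists_isStepTwo hC2 hT x ht) hθ₀,
    fun x θ hrun => ⟨?_, ?_, ?_⟩⟩
  · exact hrun.obj_succ_add_le hκ hμ hW (fun k => (hlamX k).1) hlamT.1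
  · obtain ⟨h2, h3⟩ := hrun.tendsto_steps hκ hμ hf_proper hbelow hW hmin
      (fun k => (hlamX k).1) hlamT.1
    simpa using h2.add h3
  · exact hrun.exists_tendsto_isCritical hκ hμ hf_proper hf_lsc hf_convex hbelow hC2 hW hmin hlamX
      hlamT.1
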